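/- Conventions. Let $\mathcal S$ be a poset. Joins and meets are least upper bounds and greatest lower bounds in $\mathcal S$. For $\tau\subseteq\mathcal S$ let $\Sigma(\tau)$ be the set of all joins of non-empty subsets of $\tau$ that exist in $\mathcal S$, and for $\sigma\subseteq\mathcal S$ let $\mathrm{Cl}(\sigma)$ be the set of all meets of non-empty subsets of $\sigma$ that exist in $\mathcal S$. For $\pi \subseteq \mathcal S$ let $\min\pi$ and $\max\pi$ be the sets of minimal and of maximal elements of $\pi$. A frame is a finite non-empty antichain $\tau\subseteq \mathcal S$ such that every non-empty subset of $\Sigma(\tau)$ that has a lower bound in $\mathcal S$ has a meet in $\mathcal S$, and this meet lies in $\Sigma(\tau)$. For $\sigma\subseteq\mathcal S$ and a frame $\tau$, consider the properties - $P_1(\sigma,\tau)$: $\sigma\subseteq\Sigma(\tau)$; - $P_2(\sigma,\tau)$: for every $x\in\tau$ there is at most one $y\in\sigma$ with $x\le y$. Let $\mathcal F$ be a non-empty set of frames in $\mathcal S$. The common basis complex $\mathrm{CB}(\mathcal S,\mathcal F)$ is the poset of all non-empty $\sigma\subseteq \mathcal S$ such that $P_1(\sigma,\tau)$ holds for some $\tau\in\mathcal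 F$, ordered by inclusion. The poset $\overline{\mathrm{PD}}(\mathcal S,\mathcal F)$ consists of all non-empty $\sigma\subseteq\mathcal S$ (partial decompositions) such that $P_1(\sigma,\tau)$ and $P_2(\sigma,\tau)$ hold for some $\tau\in\mathcal F$, ordered by refinement: $\sigma\le\sigma'$ if and only if every $x\in\sigma$ lies below some $y\in\sigma'$. The family $\mathcal F$ has the extension property (EP) if for all $\sigma\le\sigma'$ in $\overline{\mathrm{PD}}(\mathcal S,\mathcal F)$ there is $\tau\in\mathcal F$ such that $P_1(\sigma,\tau)$ and $P_1(\sigma',\tau)$ hold. For a poset $P$, let $\Delta P$ be its order complex, whose simplices are the non-empty finite chains of $P$; it is also regarded as a poset under inclusion. Let $|P|$ be the geometric realization of $\Delta P$ with the weak topology, let $|f|$ be the realization of an order-preserving map $f$, and let $\mathrm{sd}\colon|\Delta P|\to|P|$ be the barycentric subdivision map, affine on simplices and sending the vertex $c\in \Delta P$ to the barycenter of the simplex $c$. A $G$-poset is a poset with an action of the group $G$ by order automorphisms. A $G$-homotopy equivalence is a $G$-equivariant continuous map that has a $G$-equivariant inverse up to homotopies through $G$-equivariant maps. **Theorem.** Let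 $G$ be a group, $\mathcal S$ a $G$-poset and $\mathcal F$ a non-empty $G$-invariant set of frames in $\mathcal S$ that satisfies (EP). Then $|\mathrm{CB}(\mathcal S,\mathcal F)|$ and $|\overline{\mathrm{PD}}(\mathcal S,\mathcal F)|$ are $G$-homotopy equivalent. More precisely, $$m\colon\Delta\,\mathrm{CB}(\mathcal S,\mathcal F)\to\overline{\mathrm{PD}}(\mathcal S,\mathcal F),\quad m(c)=\max\Big(\bigcup_{\sigma\in c}\min\big(\mathrm{Cl}(\sigma)\big)\Big),$$ $$u\colon\Delta\,\overline{\mathrm{PD}}(\mathcal S,\mathcal F)\to\mathrm{CB}(\mathcal S,\mathcal F),\quad u(\{\sigma_0,\dots,\sigma_t\})=\bigcup_{i=0}^t\sigma_i$$ are well-defined, order-preserving and $G$-equivariant; $|m|$ and $|u|$ are $G$-homotopy equivalences; and there are mutually inverse $G$-homotopy equivalences $\Phi\colon|\mathrm{CB}(\mathcal S,\mathcal F)|\to|\overline{\mathrm{PD}}(\mathcal S,\mathcal F)|$ and $\Psi\colon|\overline{\mathrm{PD}}(\mathcal S,\mathcal F)|\to|\mathrm{CB}(\mathcal S,\mathcal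 F)|$ with $\Phi\circ\mathrm{sd}=|m|$ and $\Psi\circ\mathrm{sd}=|u|$. -/

import Mathlib

namespace CommonBasis

open scoped Pointwise

universe u v w

/-! ### Group actions on posets -/

/-- A `G`-poset: a poset on which the group `G` acts by order-preserving maps
(hence by poset automorphisms). -/
class IsGPoset (G : Type u) (P : Type v) [Group G] [PartialOrder P] [MulAction G P] : Prop where
  smul_le_smul : ∀ (g : G) {x y : P}, x ≤ y → g • x ≤ g • y

/-- The action of a group element, as an order-preserving map. -/
def smulHom {G : Type u} {P : Type v} [Group G] [PartialOrder P] [MulAction G P] [IsGPoset G P]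
    (g : G) : P →o P where
  toFun x := g • x
  monotone' _ _ h := IsGPoset.smul_le_smul g h

theorem smul_le_smul_iff' {G : Type u} {P : Type v} [Group G] [PartialOrder P] [MulAction G P]
    [IsGPoset G P] (g : G) {x y : P} : g • x ≤ g • y ↔ x ≤ y := by
  refine ⟨fun h => ?_, IsGPoset.smul_le_smul g⟩
  simpa using IsGPoset.smul_le_smul (g⁻¹) h

/-! ### The order complex of a poset and its geometric realization -/

/-- The order complex `Δ P` of a poset `P`: its simplices are the non-empty finite chains of `P`. -/
@[ext]
structure OrderComplex (P : Type v) [PartialOrder P] where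
  /-- the underlying chain -/
  carrier : Finset P
  nonempty : carrier.Nonempty
  isChain : IsChain (· ≤ ·) (carrier : Set P)

/-- `Δ P` is regarded as a poset (its face poset): simplices are ordered by inclusion. -/
instance OrderComplex.instPartialOrder (P : Type v) [PartialOrder P] :
    PartialOrder (OrderComplex P) :=
  PartialOrder.lift OrderComplex.carrier (fun _ _ h => OrderComplex.ext h)

/-- The induced action `g • {x₀, …, xᵣ} = {g • x₀, …, g • xᵣ}` on the order complex. -/
instance OrderComplex.instMulAction {G : Type u} {P : Type v} [Group G] [PartialOrder P]
    [MulAction G P] [IsGPoset G P] : MulAction G (OrderComplex P) where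
  smul g c :=
    { carrier := c.carrier.map (MulAction.toPerm g).toEmbedding
      nonempty := c.nonempty.map
      isChain := by
        intro x hx y hy _
        simp only [Finset.coe_map, Set.mem_image, Finset.mem_coe] at hx hy
        obtain ⟨a, ha, rfl⟩ := hx
        obtain ⟨b, hb, rfl⟩ := hy
        exact (c.isChain.total ha hb).imp (IsGPoset.smul_le_smul g) (IsGPoset.smul_le_smul g) }
  one_smul c := OrderComplex.ext (by
    ext x
    change x ∈ Finset.map _ _ ↔ _
    simp)
  mul_smul g h c := OrderComplex.ext (by
    ext x
    change x ∈ Finset.map _ _ ↔ x ∈ Finset.map _ (Finset.map _ _)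
    simp [mul_smul])

instance OrderComplex.instIsGPoset {G : Type u} {P : Type v} [Group G] [PartialOrder P]
    [MulAction G P] [IsGPoset G P] : IsGPoset G (OrderComplex P) where
  smul_le_smul _ _ _ h := Finset.map_subset_map.2 h

/-- The geometric realization `|P|` of (the order complex of) a poset `P`: formal convex
combinations of elements of `P` (barycentric coordinates) whose support is a chain. -/
@[ext]
structure Realization (P : Type v) [PartialOrder P] where
  /-- the barycentric coordinates -/
  weight : P →₀ ℝ
  nonneg : ∀ p, 0 ≤ weight p
  sum_eq_one : (weight.sum fun _ r => r) = 1
  isChain : IsChain (· ≤ ·) (weight.support : Set P)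

namespace Realization

variable {P : Type v} [PartialOrder P] {Q : Type w} [PartialOrder Q]

theorem mapDomain_nonneg {α β : Type*} (f : α → β) {x : α →₀ ℝ} (hx : ∀ a, 0 ≤ x a) (b : β) :
    0 ≤ x.mapDomain f b := by
  classical
  rw [Finsupp.mapDomain, Finsupp.sum_apply]
  refine Finset.sum_nonneg fun a _ => ?_
  change 0 ≤ Finsupp.single (f a) (x a) b
  rw [Finsupp.single_apply]
  split_ifs
  exacts [hx a, le_rfl]

theorem mapDomain_sum {α β : Type*} (f : α → β) (x : α →₀ ℝ) :
    ((x.mapDomain f).sum fun _ r => r) = x.sum fun _ r => r :=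
  Finsupp.sum_mapDomain_index (fun _ => rfl) (fun _ _ _ => rfl)

theorem mem_support_mapDomain {α β : Type*} (f : α → β) (x : α →₀ ℝ) {b : β}
    (hb : b ∈ (x.mapDomain f).support) : ∃ a ∈ x.support, f a = b := by
  classical
  simpa using Finsupp.mapDomain_support hb

/-- The closed simplex spanned by the chain `c`, as a map from the standard simplex with
vertex set `c` to the realization. -/
noncomputable def face (c : OrderComplex P) (x : stdSimplex ℝ c.carrier) : Realization P where
  weight := (Finsupp.equivFunOnFinite.symm x.1).mapDomain Subtype.val
  nonneg := mapDomain_nonneg _ x.2.1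
  sum_eq_one := by
    rw [mapDomain_sum, Finsupp.equivFunOnFinite_symm_sum]
    exact x.2.2
  isChain := c.isChain.mono fun p hp => by
    obtain ⟨a, _, rfl⟩ := mem_support_mapDomain _ _ hp
    exact a.2

/-- The weak (coherent) topology: the final topology with respect to all closed simplices, each
of which carries its Euclidean topology. -/
noncomputable instance instTopologicalSpace : TopologicalSpace (Realization P) :=
  ⨆ c : OrderComplex P, TopologicalSpace.coinduced (face c) inferInstance

/-- The underlying function of the realization of an order-preserving map: the affine
extension of `f`. -/
noncomputable def mapFun (f : P →o Q) (x : Realization P) : Realization Q where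
  weight := x.weight.mapDomain f
  nonneg := mapDomain_nonneg _ x.nonneg
  sum_eq_one := by rw [mapDomain_sum, x.sum_eq_one]
  isChain := by
    intro a ha b hb _
    obtain ⟨a, ha', rfl⟩ := mem_support_mapDomain _ _ ha
    obtain ⟨b, hb', rfl⟩ := mem_support_mapDomain _ _ hb
    exact (x.isChain.total ha' hb').imp (fun h => f.monotone h) (fun h => f.monotone h)

theorem continuous_mapFun (f : P →o Q) : Continuous (mapFun f) := by
  classical
  refine continuous_iSup_dom.2 fun c => continuous_coinduced_dom.2 ?_
  let d : OrderComplex Q :=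
    { carrier := c.carrier.image f
      nonempty := c.nonempty.image f
      isChain := by
        intro a ha b hb _
        simp only [Finset.coe_image, Set.mem_image, Finset.mem_coe] at ha hb
        obtain ⟨a, ha, rfl⟩ := ha
        obtain ⟨b, hb, rfl⟩ := hb
        exact (c.isChain.total ha hb).imp (fun h => f.monotone h) (fun h => f.monotone h) }
  let r : c.carrier → d.carrier := fun p => ⟨f p.1, Finset.mem_image_of_mem f p.2⟩
  have hd : Continuous (face d) := continuous_iff_coinduced_le.2 (le_iSup
    (fun c : OrderComplex Q => TopologicalSpace.coinduced (face c) inferInstance) d)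
  have h : mapFun f ∘ face c = face d ∘ stdSimplex.map r := by
    funext x
    apply Realization.ext
    change Finsupp.mapDomain f (Finsupp.mapDomain _ _) = Finsupp.mapDomain _ _
    have : (Finsupp.equivFunOnFinite.symm (stdSimplex.map r x).1 : d.carrier →₀ ℝ)
        = (Finsupp.equivFunOnFinite.symm x.1).mapDomain r := by
      rw [Equiv.symm_apply_eq]
      rfl
    rw [this, ← Finsupp.mapDomain_comp, ← Finsupp.mapDomain_comp]
    rfl
  rw [h]
  exact hd.comp (stdSimplex.continuous_map r)

/-- The geometric realization `|f| : |P| → |Q|` of an order-preserving map `f : P → Q`. -/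
noncomputable def map (f : P →o Q) : C(Realization P, Realization Q) :=
  ⟨mapFun f, continuous_mapFun f⟩

/-- The induced action of `G` on the realization of a `G`-poset; every `g` acts by the
homeomorphism `|g • ·|`. -/
noncomputable instance instMulAction {G : Type u} [Group G] [MulAction G P] [IsGPoset G P] :
    MulAction G (Realization P) where
  smul g x := map (smulHom g) x
  one_smul x := by
    apply Realization.ext
    change Finsupp.mapDomain (fun p => (1 : G) • p) x.weight = x.weight
    simp only [one_smul]
    exact Finsupp.mapDomain_id
  mul_smul g h x := by
    apply Realization.ext
    change Finsupp.mapDomain (fun p => (g * h) • p) x.weight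
      = Finsupp.mapDomain (fun p => g • p) (Finsupp.mapDomain (fun p => h • p) x.weight)
    rw [← Finsupp.mapDomain_comp]
    simp only [mul_smul]
    rfl

/-- The barycenter of a simplex, in barycentric coordinates. -/
noncomputable def barycenter (c : OrderComplex P) : P →₀ ℝ :=
  ∑ p ∈ c.carrier, Finsupp.single p ((c.carrier.card : ℝ)⁻¹)

theorem barycenter_nonneg (c : OrderComplex P) (p : P) : 0 ≤ barycenter c p := by
  classical
  rw [barycenter, Finsupp.finsetSum_apply]
  refine Finset.sum_nonneg fun q _ => ?_
  rw [Finsupp.single_apply]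
  split_ifs <;> positivity

theorem barycenter_sum (c : OrderComplex P) :
    Finsupp.linearCombination ℝ (fun _ : P => (1 : ℝ)) (barycenter c) = 1 := by
  have : (c.carrier.card : ℝ) ≠ 0 := by exact_mod_cast c.nonempty.card_ne_zero
  simp [barycenter, map_sum, this]

theorem mem_of_mem_support_barycenter (c : OrderComplex P) {p : P}
    (hp : p ∈ (barycenter c).support) : p ∈ c.carrier := by
  classical
  by_contra h
  refine (Finsupp.mem_support_iff.1 hp) ?_
  rw [barycenter, Finsupp.finsetSum_apply]
  refine Finset.sum_eq_zero fun q hq => ?_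
  rw [Finsupp.single_apply, if_neg]
  rintro rfl
  exact h hq

/-- The canonical identification `|Δ P| → |P|` of the barycentric subdivision with the original
complex: the affine map that sends the vertex `c` of `Δ P` (a chain of `P`) to the barycenter of
the simplex `c`. -/
noncomputable def subdivision (x : Realization (OrderComplex P)) : Realization P where
  weight := Finsupp.linearCombination ℝ barycenter x.weight
  nonneg p := by
    rw [Finsupp.linearCombination_apply, Finsupp.sum, Finsupp.finsetSum_apply]
    exact Finset.sum_nonneg fun c _ => mul_nonneg (x.nonneg c) (barycenter_nonneg c p)
  sum_eq_one := by
    have h : ∀ y : P →₀ ℝ, (y.sum fun _ r => r)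
        = Finsupp.linearCombination ℝ (fun _ : P => (1 : ℝ)) y := by
      intro y
      simp [Finsupp.linearCombination_apply]
    rw [h, Finsupp.linearCombination_apply ℝ x.weight, Finsupp.sum, map_sum]
    simp only [map_smul, barycenter_sum, smul_eq_mul, mul_one]
    exact x.sum_eq_one
  isChain := by
    classical
    have key : ∀ p ∈ (Finsupp.linearCombination ℝ barycenter x.weight).support,
        ∃ c ∈ x.weight.support, p ∈ c.carrier := by
      intro p hp
      rw [Finsupp.linearCombination_apply, Finsupp.sum] at hp
      obtain ⟨c, hc, hpc⟩ := Finset.mem_biUnion.1 (Finsupp.support_finsetSum hp)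
      exact ⟨c, hc, mem_of_mem_support_barycenter c (Finsupp.support_smul hpc)⟩
    intro p hp q hq _
    obtain ⟨c, hc, hpc⟩ := key p hp
    obtain ⟨d, hd, hqd⟩ := key q hq
    rcases x.isChain.total hc hd with h | h
    · exact d.isChain.total (h hpc) hqd
    · exact c.isChain.total hpc (h hqd)

end Realization

/-! ### Equivariant homotopy equivalences -/

/-- `f` is `G`-equivariant. -/
def IsEquivariant (G : Type u) {X : Type v} {Y : Type w} [Group G] [MulAction G X] [MulAction G Y]
    (f : X → Y) : Prop :=
  ∀ (g : G) (x : X), f (g • x) = g • f x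

/-- `f` and `f'` are `G`-homotopic: there is a homotopy between them all of whose stages are
`G`-equivariant. -/
def GHomotopic (G : Type u) {X : Type v} {Y : Type w} [Group G] [TopologicalSpace X]
    [TopologicalSpace Y] [MulAction G X] [MulAction G Y] (f f' : C(X, Y)) : Prop :=
  ContinuousMap.HomotopicWith f f' fun h => IsEquivariant G h

/-- `f` and `f'` are `G`-equivariant maps that are mutually inverse up to `G`-homotopy. -/
structure IsGHomotopyInverse (G : Type u) {X : Type v} {Y : Type w} [Group G] [TopologicalSpace X]
    [TopologicalSpace Y] [MulAction G X] [MulAction G Y] (f : C(X, Y)) (f' : C(Y, X)) : Prop where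
  equivariant : IsEquivariant G f
  equivariant' : IsEquivariant G f'
  left_inv : GHomotopic G (f'.comp f) (ContinuousMap.id X)
  right_inv : GHomotopic G (f.comp f') (ContinuousMap.id Y)

/-- `f` is a `G`-homotopy equivalence. -/
def IsGHomotopyEquiv (G : Type u) {X : Type v} {Y : Type w} [Group G] [TopologicalSpace X]
    [TopologicalSpace Y] [MulAction G X] [MulAction G Y] (f : C(X, Y)) : Prop :=
  ∃ f' : C(Y, X), IsGHomotopyInverse G f f'

/-! ### Frames and (partial) decompositions -/

section Frames

variable {S : Type v} [PartialOrder S]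

/-- `Σ(τ)`: all joins (least upper bounds) of non-empty subsets of `τ` that exist in `S`. -/
def joinSpan (τ : Set S) : Set S :=
  {z | ∃ α : Set S, α ⊆ τ ∧ α.Nonempty ∧ IsLUB α z}

/-- `Cl(σ)`: all meets (greatest lower bounds) of non-empty subsets of `σ` that exist in `S`. -/
def meetClosure (σ : Set S) : Set S :=
  {z | ∃ α : Set S, α ⊆ σ ∧ α.Nonempty ∧ IsGLB α z}

/-- The set of minimal elements of `π`. -/
def minSet (π : Set S) : Set S := {x | Minimal (· ∈ π) x}

/-- The set of maximal elements of `π`. -/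
def maxSet (π : Set S) : Set S := {x | Maximal (· ∈ π) x}

/-- A frame: a finite non-empty antichain `τ` such that every non-empty subset of `Σ(τ)` that has
a lower bound in `S` has a meet in `S`, and this meet lies in `Σ(τ)`. -/
structure IsFrame (τ : Set S) : Prop where
  finite : τ.Finite
  nonempty : τ.Nonempty
  antichain : IsAntichain (· ≤ ·) τ
  exists_meet : ∀ σ : Set S, σ ⊆ joinSpan τ → σ.Nonempty → BddBelow σ →
    ∃ z ∈ joinSpan τ, IsGLB σ z

/-- Property `P₁(σ, τ)`: every element of `σ` is a join of elements of `τ`. -/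
def P₁ (σ τ : Set S) : Prop := ∀ y ∈ σ, y ∈ joinSpan τ

/-- Property `P₂(σ, τ)`: every element of `τ` lies below at most one element of `σ`. -/
def P₂ (σ τ : Set S) : Prop := ∀ x ∈ τ, ∀ y ∈ σ, ∀ y' ∈ σ, x ≤ y → x ≤ y' → y = y'

end Frames

/-- A non-empty set of frames in the poset `S`. -/
structure FrameFamily (S : Type v) [PartialOrder S] where
  /-- the frames of the family -/
  frames : Set (Set S)
  nonempty : frames.Nonempty
  isFrame : ∀ τ ∈ frames, IsFrame τ

namespace FrameFamily

variable {S : Type v} [PartialOrder S] (F : FrameFamily S)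

/-- `F` is invariant under the action of `G`. -/
class IsInvariant (G : Type u) [Group G] [MulAction G S] : Prop where
  smul_mem : ∀ (g : G), ∀ τ ∈ F.frames, g • τ ∈ F.frames

/-- `σ` is basis compatible. -/
def IsBasisCompatible (σ : Set S) : Prop := ∃ τ ∈ F.frames, P₁ σ τ

/-- `σ` is a partial decomposition. -/
def IsPartialDecomposition (σ : Set S) : Prop := ∃ τ ∈ F.frames, P₁ σ τ ∧ P₂ σ τ

/-- The common basis complex, as the poset of its non-empty simplices: the non-empty basis
compatible subsets of `S`, ordered by inclusion. -/
@[ext]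
structure CB where
  /-- the underlying subset -/
  carrier : Set S
  nonempty : carrier.Nonempty
  compatible : F.IsBasisCompatible carrier

/-- The poset of non-empty partial decompositions (ordered by refinement, see below). -/
@[ext]
structure PD where
  /-- the underlying subset -/
  carrier : Set S
  nonempty : carrier.Nonempty
  isPartialDecomposition : F.IsPartialDecomposition carrier

instance CB.instPartialOrder : PartialOrder F.CB :=
  PartialOrder.lift CB.carrier (fun _ _ h => CB.ext h)

variable {F}

theorem PD.eq_of_le_of_le (σ : F.PD) {x y z : S} (hy : y ∈ σ.carrier) (hz : z ∈ σ.carrier)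
    (hxy : x ≤ y) (hxz : x ≤ z) : y = z := by
  obtain ⟨τ, hτ, h1, h2⟩ := σ.isPartialDecomposition
  obtain ⟨w, ⟨α, hα, ⟨a, ha⟩, hw⟩, hm⟩ := (F.isFrame τ hτ).exists_meet {y, z}
    (by rintro _ (rfl | rfl) <;> exact h1 _ ‹_›) ⟨y, by simp⟩
    ⟨x, by rintro _ (rfl | rfl) <;> assumption⟩
  exact h2 a (hα ha) y hy z hz ((hw.1 ha).trans (hm.1 (by simp))) ((hw.1 ha).trans (hm.1 (by simp)))

/-- Refinement: `σ ≤ σ'` iff every element of `σ` lies below some element of `σ'`. -/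
instance PD.instPartialOrder : PartialOrder F.PD where
  le σ σ' := ∀ x ∈ σ.carrier, ∃ y ∈ σ'.carrier, x ≤ y
  le_refl σ x hx := ⟨x, hx, le_rfl⟩
  le_trans σ₁ σ₂ σ₃ h h' x hx := by
    obtain ⟨y, hy, hxy⟩ := h x hx
    obtain ⟨z, hz, hyz⟩ := h' y hy
    exact ⟨z, hz, hxy.trans hyz⟩
  le_antisymm := by
    have key : ∀ σ σ' : F.PD, (∀ x ∈ σ.carrier, ∃ y ∈ σ'.carrier, x ≤ y) →
        (∀ x ∈ σ'.carrier, ∃ y ∈ σ.carrier, x ≤ y) → σ.carrier ⊆ σ'.carrier := by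
      intro σ σ' h h' x hx
      obtain ⟨y, hy, hxy⟩ := h x hx
      obtain ⟨z, hz, hyz⟩ := h' y hy
      have : x = z := σ.eq_of_le_of_le hx hz le_rfl (hxy.trans hyz)
      subst this
      rwa [le_antisymm hxy hyz]
    exact fun σ σ' h h' => PD.ext ((key σ σ' h h').antisymm (key σ' σ h' h))

variable (F)

/-- The extension property (EP): any two comparable elements `σ ≤ σ'` of the poset of partial
decompositions are both generated by a common frame of the family. -/
def EP : Prop :=
  ∀ σ σ' : F.PD, σ ≤ σ' → ∃ τ ∈ F.frames, P₁ σ.carrier τ ∧ P₁ σ'.carrier τ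

section Action

variable {F} {G : Type u} [Group G] [MulAction G S] [IsGPoset G S]

theorem smul_mem_joinSpan (g : G) {τ : Set S} {y : S} (hy : y ∈ joinSpan τ) :
    g • y ∈ joinSpan (g • τ) := by
  obtain ⟨α, hα, hne, hlub⟩ := hy
  refine ⟨g • α, Set.smul_set_mono hα, hne.smul_set, ?_, ?_⟩
  · rintro _ ⟨a, ha, rfl⟩
    exact IsGPoset.smul_le_smul g (hlub.1 ha)
  · intro b hb
    have : y ≤ g⁻¹ • b := hlub.2 fun a ha => by
      rw [← smul_le_smul_iff' g, smul_inv_smul]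
      exact hb (Set.smul_mem_smul_set ha)
    simpa using IsGPoset.smul_le_smul g this

theorem smul_P₁ (g : G) {σ τ : Set S} (h : P₁ σ τ) : P₁ (g • σ) (g • τ) := by
  rintro _ ⟨y, hy, rfl⟩
  exact smul_mem_joinSpan g (h y hy)

theorem smul_P₂ (g : G) {σ τ : Set S} (h : P₂ σ τ) : P₂ (g • σ) (g • τ) := by
  rintro _ ⟨x, hx, rfl⟩ _ ⟨y, hy, rfl⟩ _ ⟨y', hy', rfl⟩ h1 h2
  rw [h x hx y hy y' hy' ((smul_le_smul_iff' g).1 h1) ((smul_le_smul_iff' g).1 h2)]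

variable [F.IsInvariant G]

/-- The induced action `g • σ = {g • x | x ∈ σ}` on the common basis complex. -/
instance CB.instMulAction : MulAction G F.CB where
  smul g σ :=
    { carrier := g • σ.carrier
      nonempty := σ.nonempty.smul_set
      compatible := by
        obtain ⟨τ, hτ, h⟩ := σ.compatible
        exact ⟨g • τ, IsInvariant.smul_mem g τ hτ, smul_P₁ g h⟩ }
  one_smul σ := CB.ext (one_smul G σ.carrier)
  mul_smul g h σ := CB.ext (mul_smul g h σ.carrier)

instance CB.instIsGPoset : IsGPoset G F.CB where
  smul_le_smul _ _ _ h := Set.smul_set_mono h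

/-- The induced action `g • σ = {g • x | x ∈ σ}` on the poset of partial decompositions. -/
instance PD.instMulAction : MulAction G F.PD where
  smul g σ :=
    { carrier := g • σ.carrier
      nonempty := σ.nonempty.smul_set
      isPartialDecomposition := by
        obtain ⟨τ, hτ, h, h'⟩ := σ.isPartialDecomposition
        exact ⟨g • τ, IsInvariant.smul_mem g τ hτ, smul_P₁ g h, smul_P₂ g h'⟩ }
  one_smul σ := PD.ext (one_smul G σ.carrier)
  mul_smul g h σ := PD.ext (mul_smul g h σ.carrier)

instance PD.instIsGPoset : IsGPoset G F.PD where
  smul_le_smul g σ σ' h := by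
    rintro _ ⟨x, hx, rfl⟩
    obtain ⟨y, hy, hxy⟩ := h x hx
    exact ⟨g • y, Set.smul_mem_smul_set hy, IsGPoset.smul_le_smul g hxy⟩

end Action

end FrameFamily

end CommonBasis

open CommonBasis

/-! Both maps live on order complexes, so the composites to be compared with the identity are
$u\circ\Delta m$ on $\Delta\Delta\,\mathrm{CB}$ and $m\circ\Delta u$ on
$\Delta\Delta\,\overline{\mathrm{PD}}$, and the identity is represented there by "last vertex of the
last vertex". On the $\mathrm{CB}$ side both this map and $u\circ\Delta m$ lie below its composite
with $\mathrm{Cl}$; on the $\overline{\mathrm{PD}}$ side $m\circ\Delta u$ refines the last-vertex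
map directly. Comparable equivariant maps have $G$-homotopic realizations (`gHomotopic_map_of_le`).

The passage back to $|\mathrm{CB}|$ and $|\overline{\mathrm{PD}}|$ rests on two facts: `sd` is an
equivariant homeomorphism, hence can be cancelled, and it is $G$-homotopic to the realization of the
last-vertex map, hence natural up to $G$-homotopy. Thus $\Phi=|m|\circ\mathrm{sd}^{-1}$ and
$\Psi=|u|\circ\mathrm{sd}^{-1}$ are mutually inverse. Every homotopy is built from linear ones
between contiguous maps, which are automatically equivariant.

The combinatorial input is that $m$ and $u$ are well defined. For $m$, bounded pairs in
$\mathrm{Cl}(\sigma)$ have meets in $\mathrm{Cl}(\sigma)$, which forces $P_2$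
(`isPartialDecomposition_maxSet_minUnion`); for $u$, (EP) extends from pairs to finite chains
(`EP.exists_frame`). -/

namespace CommonBasis

open unitInterval

/-! ### Realizations: coordinates, affine maps and linear homotopies -/

namespace Realization

variable {P : Type*} [PartialOrder P] {Q : Type*} [PartialOrder Q]

/-! ### Points of the realization in barycentric coordinates -/

theorem continuous_face (c : OrderComplex P) : Continuous (face c) :=
  continuous_iff_coinduced_le.2 (le_iSup
    (fun c : OrderComplex P => TopologicalSpace.coinduced (face c) inferInstance) c)

theorem continuous_iff_comp_face {Y : Type*} [TopologicalSpace Y] {f : Realization P → Y} :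
    Continuous f ↔ ∀ c, Continuous (f ∘ face c) := by
  refine ⟨fun h c => h.comp (continuous_face c), fun h => ?_⟩
  exact continuous_iSup_dom.2 fun c => continuous_coinduced_dom.2 (h c)

theorem isClosed_iff_preimage_face {A : Set (Realization P)} :
    IsClosed A ↔ ∀ c, IsClosed (face c ⁻¹' A) := by
  rw [isClosed_iSup_iff]
  exact forall_congr' fun c => isClosed_coinduced

theorem face_weight_of_mem (c : OrderComplex P) (x : stdSimplex ℝ c.carrier) {p : P}
    (hp : p ∈ c.carrier) : (face c x).weight p = x.1 ⟨p, hp⟩ := by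
  change Finsupp.mapDomain _ _ ((⟨p, hp⟩ : c.carrier) : P) = _
  rw [Finsupp.mapDomain_apply Subtype.val_injective]
  rfl

theorem face_support_subset (c : OrderComplex P) (x : stdSimplex ℝ c.carrier) :
    (face c x).weight.support ⊆ c.carrier := fun p hp => by
  obtain ⟨a, _, rfl⟩ := mem_support_mapDomain _ _ hp
  exact a.2

theorem face_weight_of_notMem (c : OrderComplex P) (x : stdSimplex ℝ c.carrier) {p : P}
    (hp : p ∉ c.carrier) : (face c x).weight p = 0 :=
  Finsupp.notMem_support_iff.1 fun h => hp (face_support_subset c x h)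

/-- The barycentric coordinates of a point with respect to a simplex that contains it. -/
noncomputable def coordsIn (c : OrderComplex P) (x : Realization P)
    (hx : x.weight.support ⊆ c.carrier) : stdSimplex ℝ c.carrier :=
  ⟨fun p => x.weight p, fun p => x.nonneg p, by
    rw [Finset.sum_coe_sort c.carrier fun p => x.weight p, ← x.sum_eq_one, Finsupp.sum]
    exact (Finset.sum_subset hx fun p _ hp => Finsupp.notMem_support_iff.1 hp).symm⟩

theorem face_coordsIn (c : OrderComplex P) (x : Realization P)
    (hx : x.weight.support ⊆ c.carrier) : face c (coordsIn c x hx) = x := by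
  apply Realization.ext
  ext p
  by_cases hp : p ∈ c.carrier
  · rw [face_weight_of_mem c _ hp]
    rfl
  · rw [face_weight_of_notMem c _ hp, Finsupp.notMem_support_iff.1 fun h => hp (hx h)]

theorem support_nonempty (x : Realization P) : x.weight.support.Nonempty := by
  by_contra h
  have := x.sum_eq_one
  rw [Finsupp.sum, Finset.not_nonempty_iff_eq_empty.1 h] at this
  simp at this

/-- The smallest simplex that contains a given point. -/
noncomputable def carrierSimplex (x : Realization P) : OrderComplex P :=
  ⟨x.weight.support, x.support_nonempty, x.isChain⟩

theorem support_subset_carrierSimplex (x : Realization P) :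
    x.weight.support ⊆ x.carrierSimplex.carrier := subset_rfl

theorem continuous_weight (p : P) : Continuous fun x : Realization P => x.weight p := by
  refine continuous_iff_comp_face.2 fun c => ?_
  by_cases hp : p ∈ c.carrier
  · have : (fun x : Realization P => x.weight p) ∘ face c = fun x => x.1 ⟨p, hp⟩ :=
      funext fun x => face_weight_of_mem c x hp
    rw [this]
    exact (continuous_apply _).comp continuous_subtype_val
  · have : (fun x : Realization P => x.weight p) ∘ face c = fun _ => 0 :=
      funext fun x => face_weight_of_notMem c x hp
    rw [this]
    exact continuous_const

/-- The coordinates embed the realization continuously and injectively into a product of lines.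
Separation is used to see that compact images under subdivision are closed. -/
instance : T2Space (Realization P) := by
  have h : Continuous fun x : Realization P => fun p => x.weight p :=
    continuous_pi continuous_weight
  refine T2Space.of_injective_continuous (fun x y hxy => ?_) h
  exact Realization.ext (DFunLike.coe_injective hxy)

/-- A map into a single simplex is continuous as soon as its barycentric coordinates are. -/
theorem continuous_of_support_subset {A : Type*} [TopologicalSpace A] {f : A → Realization Q}
    (d : OrderComplex Q) (hd : ∀ a, (f a).weight.support ⊆ d.carrier)
    (hf : ∀ q, Continuous fun a => (f a).weight q) : Continuous f := by
  have : f = face d ∘ fun a => coordsIn d (f a) (hd a) :=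
    funext fun a => (face_coordsIn d (f a) (hd a)).symm
  rw [this]
  refine (continuous_face d).comp (Continuous.subtype_mk ?_ _)
  exact continuous_pi fun q => hf q

theorem sum_eq_linearCombination_one {α : Type*} (y : α →₀ ℝ) :
    (y.sum fun _ r => r) = Finsupp.linearCombination ℝ (fun _ : α => (1 : ℝ)) y := by
  simp [Finsupp.linearCombination_apply]

/-! ### Affine extension of a map on vertices -/

/-- `v` sends the vertices of every simplex into a common simplex. -/
def IsCarried (v : P → Realization Q) : Prop :=
  ∀ c : OrderComplex P, ∃ d : OrderComplex Q, ∀ p ∈ c.carrier, (v p).weight.support ⊆ d.carrier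

theorem support_linearCombination_subset {α : Type*} (v : α → Realization Q) (y : α →₀ ℝ)
    {d : Finset Q} (hd : ∀ p ∈ y.support, (v p).weight.support ⊆ d) :
    (Finsupp.linearCombination ℝ (fun p => (v p).weight) y).support ⊆ d := by
  classical
  intro q hq
  rw [Finsupp.linearCombination_apply, Finsupp.sum] at hq
  obtain ⟨p, hp, hpq⟩ := Finset.mem_biUnion.1 (Finsupp.support_finsetSum hq)
  exact hd p hp (Finsupp.support_smul hpq)

/-- The affine extension of a carried map on vertices. -/
noncomputable def affineFun (v : P → Realization Q) (hv : IsCarried v) (x : Realization P) :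
    Realization Q where
  weight := Finsupp.linearCombination ℝ (fun p => (v p).weight) x.weight
  nonneg q := by
    rw [Finsupp.linearCombination_apply, Finsupp.sum, Finsupp.finsetSum_apply]
    exact Finset.sum_nonneg fun p _ => mul_nonneg (x.nonneg p) ((v p).nonneg q)
  sum_eq_one := by
    have h : ∀ p, Finsupp.linearCombination ℝ (fun _ : Q => (1 : ℝ)) (v p).weight = 1 := fun p => by
      rw [← sum_eq_linearCombination_one, (v p).sum_eq_one]
    rw [sum_eq_linearCombination_one, Finsupp.linearCombination_apply ℝ x.weight, Finsupp.sum,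
      map_sum]
    simp only [map_smul, h, smul_eq_mul, mul_one]
    exact x.sum_eq_one
  isChain := by
    obtain ⟨d, hd⟩ := hv x.carrierSimplex
    exact d.isChain.mono (support_linearCombination_subset v x.weight hd)

theorem continuous_affineFun (v : P → Realization Q) (hv : IsCarried v) :
    Continuous (affineFun v hv) := by
  refine continuous_iff_comp_face.2 fun c => ?_
  obtain ⟨d, hd⟩ := hv c
  refine continuous_of_support_subset d (fun x => support_linearCombination_subset v _ fun p hp =>
    hd p (face_support_subset c x hp)) fun q => ?_
  have h : (fun x => ((affineFun v hv ∘ face c) x).weight q)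
      = fun x => ∑ p ∈ c.carrier, (face c x).weight p * (v p).weight q := by
    funext x
    change Finsupp.linearCombination ℝ (fun p => (v p).weight) (face c x).weight q = _
    rw [Finsupp.linearCombination_apply, Finsupp.sum, Finsupp.finsetSum_apply]
    refine Finset.sum_subset (face_support_subset c x) fun p _ hp => ?_
    simp [Finsupp.notMem_support_iff.1 hp]
  rw [h]
  exact continuous_finsetSum _ fun p _ =>
    ((continuous_weight p).comp (continuous_face c)).mul continuous_const

/-- The affine extension of a carried map on vertices, as a continuous map. -/
noncomputable def affine (v : P → Realization Q) (hv : IsCarried v) :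
    C(Realization P, Realization Q) :=
  ⟨affineFun v hv, continuous_affineFun v hv⟩

theorem affine_support_subset {v : P → Realization Q} (hv : IsCarried v) {c : Finset P}
    {d : Finset Q} (hd : ∀ p ∈ c, (v p).weight.support ⊆ d) {x : Realization P}
    (hx : x.weight.support ⊆ c) : (affine v hv x).weight.support ⊆ d :=
  support_linearCombination_subset v _ fun p hp => hd p (hx hp)

theorem map_support_subset (f : P →o Q) {c : Finset P} {d : Finset Q} (hd : ∀ p ∈ c, f p ∈ d)
    {x : Realization P} (hx : x.weight.support ⊆ c) : (map f x).weight.support ⊆ d := by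
  intro q hq
  obtain ⟨p, hp, rfl⟩ := mem_support_mapDomain _ _ hq
  exact hd p (hx hp)

theorem map_comp {R : Type*} [PartialOrder R] (g : Q →o R) (f : P →o Q) :
    map (g.comp f) = (map g).comp (map f) := by
  ext1 x
  apply Realization.ext
  change x.weight.mapDomain (g ∘ f) = (x.weight.mapDomain f).mapDomain g
  exact Finsupp.mapDomain_comp

/-! ### Equivariance -/

section Equivariance

variable {G : Type*} [Group G] [MulAction G P] [IsGPoset G P] [MulAction G Q] [IsGPoset G Q]

theorem isEquivariant_affine {v : P → Realization Q} (hv : IsCarried v) (h : IsEquivariant G v) :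
    IsEquivariant G (affine v hv) := by
  intro g x
  apply Realization.ext
  change Finsupp.linearCombination ℝ _ (x.weight.mapDomain fun p => g • p)
    = Finsupp.lmapDomain ℝ ℝ (fun q => g • q) (Finsupp.linearCombination ℝ _ x.weight)
  rw [Finsupp.linearCombination_mapDomain, Finsupp.apply_linearCombination]
  congr 2
  funext p
  exact congrArg weight (h g p)

theorem isEquivariant_map {f : P →o Q} (h : IsEquivariant G f) : IsEquivariant G (map f) := by
  intro g x
  apply Realization.ext
  change (x.weight.mapDomain fun p => g • p).mapDomain f
    = (x.weight.mapDomain f).mapDomain fun q => g • q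
  rw [← Finsupp.mapDomain_comp, ← Finsupp.mapDomain_comp]
  congr 1
  funext p
  exact h g p

end Equivariance

/-! ### Linear homotopies -/

/-- The point dividing the segment between two points of a common simplex. -/
noncomputable def segment (x y : Realization P)
    (h : ∃ d : OrderComplex P, x.weight.support ⊆ d.carrier ∧ y.weight.support ⊆ d.carrier)
    (t : I) : Realization P where
  weight := (1 - t : ℝ) • x.weight + (t : ℝ) • y.weight
  nonneg p := add_nonneg (mul_nonneg (sub_nonneg.2 t.2.2) (x.nonneg p))
    (mul_nonneg t.2.1 (y.nonneg p))
  sum_eq_one := by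
    rw [sum_eq_linearCombination_one, map_add, map_smul, map_smul,
      ← sum_eq_linearCombination_one, ← sum_eq_linearCombination_one, x.sum_eq_one,
      y.sum_eq_one]
    simp
  isChain := by
    classical
    obtain ⟨d, hx, hy⟩ := h
    refine d.isChain.mono fun p hp => ?_
    rcases Finset.mem_union.1 (Finsupp.support_add hp) with h | h
    · exact hx (Finsupp.support_smul h)
    · exact hy (Finsupp.support_smul h)

theorem segment_support_subset {x y : Realization P} {h} {t : I} {d : Finset P}
    (hx : x.weight.support ⊆ d) (hy : y.weight.support ⊆ d) :
    (segment x y h t).weight.support ⊆ d := by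
  classical
  intro p hp
  rcases Finset.mem_union.1 (Finsupp.support_add hp) with h | h
  · exact hx (Finsupp.support_smul h)
  · exact hy (Finsupp.support_smul h)

/-- Maps `f` and `f'` are contiguous if they send every simplex into a common simplex. -/
def Contiguous (f f' : C(Realization P, Realization Q)) : Prop :=
  ∀ c : OrderComplex P, ∃ d : OrderComplex Q, ∀ x : Realization P, x.weight.support ⊆ c.carrier →
    (f x).weight.support ⊆ d.carrier ∧ (f' x).weight.support ⊆ d.carrier

theorem Contiguous.exists_simplex {f f' : C(Realization P, Realization Q)} (h : Contiguous f f')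
    (x : Realization P) : ∃ d : OrderComplex Q, (f x).weight.support ⊆ d.carrier ∧
      (f' x).weight.support ⊆ d.carrier := by
  obtain ⟨d, hd⟩ := h x.carrierSimplex
  exact ⟨d, hd x subset_rfl⟩

/-- The weak topology is tested on simplices, but the product with `I` is not given as a final
topology. Currying avoids this: a map from the realization to $C(I,|Q|)$ can be tested on simplices,
and uncurrying is continuous because `I` is locally compact. -/
theorem Contiguous.continuous_segment {f f' : C(Realization P, Realization Q)}
    (h : Contiguous f f') :
    Continuous fun z : I × Realization P =>
      segment (f z.2) (f' z.2) (h.exists_simplex z.2) z.1 := by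
  have hface (c : OrderComplex P) : Continuous fun z : stdSimplex ℝ c.carrier × I =>
      segment (f (face c z.1)) (f' (face c z.1)) (h.exists_simplex _) z.2 := by
    obtain ⟨d, hd⟩ := h c
    refine continuous_of_support_subset d (fun z => ?_) fun q => ?_
    · obtain ⟨h1, h2⟩ := hd (face c z.1) (face_support_subset c z.1)
      exact segment_support_subset h1 h2
    · change Continuous fun z : stdSimplex ℝ c.carrier × I =>
        (1 - z.2 : ℝ) * (f (face c z.1)).weight q + (z.2 : ℝ) * (f' (face c z.1)).weight q
      have h1 (k : C(Realization P, Realization Q)) :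
          Continuous fun z : stdSimplex ℝ c.carrier × I => (k (face c z.1)).weight q :=
        (continuous_weight q).comp (k.continuous.comp ((continuous_face c).comp continuous_fst))
      have h2 : Continuous fun z : stdSimplex ℝ c.carrier × I => (z.2 : ℝ) :=
        continuous_subtype_val.comp continuous_snd
      exact ((continuous_const.sub h2).mul (h1 f)).add (h2.mul (h1 f'))
  have hpath (x : Realization P) :
      Continuous fun t : I => segment (f x) (f' x) (h.exists_simplex x) t := by
    obtain ⟨d, h1, h2⟩ := h.exists_simplex x
    refine continuous_of_support_subset d (fun t => segment_support_subset h1 h2) fun q => ?_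
    change Continuous fun t : I => (1 - t : ℝ) * (f x).weight q + (t : ℝ) * (f' x).weight q
    fun_prop
  let k : Realization P → C(I, Realization Q) := fun x => ⟨_, hpath x⟩
  have hk : Continuous k := by
    refine continuous_iff_comp_face.2 fun c => ?_
    refine ContinuousMap.continuous_of_continuous_uncurry (k ∘ face c) ?_
    exact hface c
  let K : C(Realization P, C(I, Realization Q)) := ⟨k, hk⟩
  have h1 : Continuous (Function.uncurry fun x t => K x t) :=
    ContinuousMap.continuous_uncurry_of_continuous K
  have h2 : Continuous fun z : I × Realization P => (z.2, z.1) :=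
    continuous_snd.prodMk continuous_fst
  have h3 (x t) : K x t = segment (f x) (f' x) (h.exists_simplex x) t := rfl
  refine (h1.comp h2).congr fun z => ?_
  exact h3 z.2 z.1

/-- Contiguous equivariant maps are `G`-homotopic, by the linear homotopy. -/
theorem Contiguous.gHomotopic {G : Type*} [Group G] [MulAction G P] [IsGPoset G P] [MulAction G Q]
    [IsGPoset G Q] {f f' : C(Realization P, Realization Q)} (h : Contiguous f f')
    (hf : IsEquivariant G f) (hf' : IsEquivariant G f') : GHomotopic G f f' := by
  refine ⟨{ toFun := fun z => segment (f z.2) (f' z.2) (h.exists_simplex z.2) z.1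
            continuous_toFun := h.continuous_segment
            map_zero_left := fun x => ?_
            map_one_left := fun x => ?_
            prop' := fun t g x => ?_ }⟩
  · apply Realization.ext
    simp [segment]
  · apply Realization.ext
    simp [segment]
  · apply Realization.ext
    change (1 - t : ℝ) • (f (g • x)).weight + (t : ℝ) • (f' (g • x)).weight
      = Finsupp.lmapDomain ℝ ℝ (fun q => g • q)
        ((1 - t : ℝ) • (f x).weight + (t : ℝ) • (f' x).weight)
    rw [hf g x, hf' g x, map_add, map_smul, map_smul]
    rfl

end Realization

/-! ### Composition of equivariant maps and homotopies -/

theorem IsEquivariant.comp {G : Type*} [Group G] {X Y Z : Type*} [MulAction G X] [MulAction G Y]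
    [MulAction G Z] {f : Y → Z} {f' : X → Y} (hf : IsEquivariant G f)
    (hf' : IsEquivariant G f') : IsEquivariant G (f ∘ f') := fun g x => by
  rw [Function.comp_apply, hf' g x, hf g, Function.comp_apply]

section Composition

variable {G : Type*} [Group G] {X Y Z : Type*} [TopologicalSpace X] [TopologicalSpace Y]
  [TopologicalSpace Z] [MulAction G X] [MulAction G Y] [MulAction G Z]

theorem GHomotopic.comp_left {f f' : C(X, Y)} (h : GHomotopic G f f') {k : C(Y, Z)}
    (hk : IsEquivariant G k) : GHomotopic G (k.comp f) (k.comp f') := by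
  obtain ⟨H⟩ := h
  refine ⟨{ toHomotopy := (ContinuousMap.Homotopy.refl k).comp H.toHomotopy
            prop' := fun t g x => ?_ }⟩
  exact (congrArg k (H.prop' t g x)).trans (hk g _)

theorem GHomotopic.comp_right {f f' : C(Y, Z)} (h : GHomotopic G f f') {k : C(X, Y)}
    (hk : IsEquivariant G k) : GHomotopic G (f.comp k) (f'.comp k) := by
  obtain ⟨H⟩ := h
  refine ⟨{ toHomotopy := H.toHomotopy.comp (ContinuousMap.Homotopy.refl k)
            prop' := fun t g x => ?_ }⟩
  exact (congrArg (fun y => H.toHomotopy (t, y)) (hk g x)).trans (H.prop' t g (k x))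

end Composition

end CommonBasis

/-! ### Order complexes and barycentric subdivision -/

namespace CommonBasis

/-! ### The order complex as a functor, first and last vertices -/

namespace OrderComplex

variable {P : Type*} [PartialOrder P] {Q : Type*} [PartialOrder Q]

theorem carrier_injective : Function.Injective (carrier : OrderComplex P → Finset P) :=
  fun _ _ h => OrderComplex.ext h

theorem exists_isGreatest (c : OrderComplex P) : ∃ p, IsGreatest (c.carrier : Set P) p := by
  obtain ⟨p, hp, hmax⟩ := c.carrier.exists_maximal c.nonempty
  exact ⟨p, hp, fun q hq => (c.isChain.total hq hp).elim id fun h => hmax hq h⟩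

theorem exists_isLeast (c : OrderComplex P) : ∃ p, IsLeast (c.carrier : Set P) p := by
  obtain ⟨p, hp, hmin⟩ := c.carrier.exists_minimal c.nonempty
  exact ⟨p, hp, fun q hq => (c.isChain.total hp hq).elim id fun h => hmin hq h⟩

/-- The last vertex of a simplex. -/
noncomputable def last (c : OrderComplex P) : P := c.exists_isGreatest.choose

/-- The first vertex of a simplex. -/
noncomputable def first (c : OrderComplex P) : P := c.exists_isLeast.choose

theorem isGreatest_last (c : OrderComplex P) : IsGreatest (c.carrier : Set P) c.last :=
  c.exists_isGreatest.choose_spec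

theorem isLeast_first (c : OrderComplex P) : IsLeast (c.carrier : Set P) c.first :=
  c.exists_isLeast.choose_spec

theorem last_mem (c : OrderComplex P) : c.last ∈ c.carrier := c.isGreatest_last.1

theorem first_mem (c : OrderComplex P) : c.first ∈ c.carrier := c.isLeast_first.1

theorem le_last (c : OrderComplex P) {p : P} (hp : p ∈ c.carrier) : p ≤ c.last :=
  c.isGreatest_last.2 hp

theorem first_le (c : OrderComplex P) {p : P} (hp : p ∈ c.carrier) : c.first ≤ p :=
  c.isLeast_first.2 hp

/-- The order-preserving map `Δ P → P` that sends a chain to its largest element. -/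
noncomputable def lastHom (P : Type*) [PartialOrder P] : OrderComplex P →o P where
  toFun := last
  monotone' c d h := d.le_last (h c.last_mem)

/-- The image of a chain under an order-preserving map. -/
noncomputable def mapHom (f : P →o Q) : OrderComplex P →o OrderComplex Q where
  toFun c :=
    { carrier := by classical exact c.carrier.image f
      nonempty := by classical exact c.nonempty.image f
      isChain := by
        classical
        rw [Finset.coe_image]
        rintro _ ⟨p, hp, rfl⟩ _ ⟨q, hq, rfl⟩ _
        exact (c.isChain.total hp hq).imp (fun h => f.monotone h) fun h => f.monotone h }
  monotone' c d h := by
    classical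
    exact Finset.image_subset_image h

theorem mem_mapHom {f : P →o Q} {c : OrderComplex P} {q : Q} :
    q ∈ (mapHom f c).carrier ↔ ∃ p ∈ c.carrier, f p = q := by
  classical
  exact Finset.mem_image

theorem last_mapHom (f : P →o Q) (c : OrderComplex P) : (mapHom f c).last = f c.last := by
  refine (mapHom f c).isGreatest_last.unique ⟨mem_mapHom.2 ⟨_, c.last_mem, rfl⟩, fun q hq => ?_⟩
  obtain ⟨p, hp, rfl⟩ := mem_mapHom.1 hq
  exact f.monotone (c.le_last hp)

/-- Applied twice, this shows that only finitely many flags of simplices subdivide a given simplex.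
-/
theorem finite_setOf_carrier_subset {s : Set P} (hs : s.Finite) :
    {c : OrderComplex P | (c.carrier : Set P) ⊆ s}.Finite := by
  refine ((Finset.finite_toSet hs.toFinset.powerset).preimage
    carrier_injective.injOn).subset fun c hc => ?_
  rw [Set.mem_preimage, Finset.mem_coe, Finset.mem_powerset]
  exact fun p hp => hs.mem_toFinset.2 (hc hp)

section Equivariance

variable {G : Type*} [Group G] [MulAction G P] [IsGPoset G P] [MulAction G Q] [IsGPoset G Q]

theorem mem_smul {g : G} {c : OrderComplex P} {p : P} :
    p ∈ (g • c).carrier ↔ ∃ q ∈ c.carrier, g • q = p :=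
  Finset.mem_map

theorem isEquivariant_last : IsEquivariant G (last : OrderComplex P → P) := by
  intro g c
  refine (g • c).isGreatest_last.unique ⟨mem_smul.2 ⟨_, c.last_mem, rfl⟩, fun p hp => ?_⟩
  obtain ⟨q, hq, rfl⟩ := mem_smul.1 hp
  exact IsGPoset.smul_le_smul g (c.le_last hq)

theorem isEquivariant_first : IsEquivariant G (first : OrderComplex P → P) := by
  intro g c
  refine (g • c).isLeast_first.unique ⟨mem_smul.2 ⟨_, c.first_mem, rfl⟩, fun p hp => ?_⟩
  obtain ⟨q, hq, rfl⟩ := mem_smul.1 hp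
  exact IsGPoset.smul_le_smul g (c.first_le hq)

theorem isEquivariant_mapHom {f : P →o Q} (hf : IsEquivariant G f) :
    IsEquivariant G (mapHom f) := by
  intro g c
  apply OrderComplex.ext
  ext q
  rw [mem_mapHom, mem_smul]
  constructor
  · rintro ⟨_, hgp, rfl⟩
    obtain ⟨p, hp, rfl⟩ := mem_smul.1 hgp
    exact ⟨f p, mem_mapHom.2 ⟨p, hp, rfl⟩, (hf g p).symm⟩
  · rintro ⟨_, hq, rfl⟩
    obtain ⟨p, hp, rfl⟩ := mem_mapHom.1 hq
    exact ⟨g • p, mem_smul.2 ⟨p, hp, rfl⟩, hf g p⟩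

end Equivariance

end OrderComplex

namespace Realization

variable {P : Type*} [PartialOrder P] {Q : Type*} [PartialOrder Q]

/-! ### Barycentric subdivision is a homeomorphism -/

theorem barycenter_apply_of_mem {c : OrderComplex P} {p : P} (hp : p ∈ c.carrier) :
    barycenter c p = (c.carrier.card : ℝ)⁻¹ := by
  classical
  rw [barycenter, Finsupp.finsetSum_apply, Finset.sum_eq_single_of_mem p hp]
  · exact Finsupp.single_eq_same
  · intro q _ hq
    exact Finsupp.single_eq_of_ne hq.symm

theorem barycenter_apply_of_notMem {c : OrderComplex P} {p : P} (hp : p ∉ c.carrier) :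
    barycenter c p = 0 :=
  Finsupp.notMem_support_iff.1 fun h => hp (mem_of_mem_support_barycenter c h)

theorem inv_card_pos (c : OrderComplex P) : 0 < (c.carrier.card : ℝ)⁻¹ :=
  inv_pos.2 (by exact_mod_cast c.nonempty.card_pos)

theorem linearCombination_barycenter_apply (x : OrderComplex P →₀ ℝ) (p : P) :
    Finsupp.linearCombination ℝ barycenter x p = ∑ c ∈ x.support, x c * barycenter c p := by
  rw [Finsupp.linearCombination_apply, Finsupp.sum, Finsupp.finsetSum_apply]
  rfl

theorem mem_support_linearCombination_barycenter {x : OrderComplex P →₀ ℝ} (hx : ∀ c, 0 ≤ x c)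
    {p : P} : p ∈ (Finsupp.linearCombination ℝ barycenter x).support ↔
      ∃ c ∈ x.support, p ∈ c.carrier := by
  rw [Finsupp.mem_support_iff, linearCombination_barycenter_apply]
  constructor
  · intro h
    obtain ⟨c, hc, hne⟩ := Finset.exists_ne_zero_of_sum_ne_zero h
    exact ⟨c, hc, by_contra fun hp => hne (by rw [barycenter_apply_of_notMem hp, mul_zero])⟩
  · rintro ⟨c, hc, hp⟩
    refine (Finset.sum_pos' (fun d _ => mul_nonneg (hx d) (barycenter_nonneg d p))
      ⟨c, hc, ?_⟩).ne'
    rw [barycenter_apply_of_mem hp]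
    exact mul_pos ((hx c).lt_of_ne' (Finsupp.mem_support_iff.1 hc)) (inv_card_pos c)

/-- In a combination of the barycenters of a flag of simplices, the coefficient of the largest
simplex is determined by the smallest coordinate. -/
theorem isLeast_linearCombination_barycenter {x : OrderComplex P →₀ ℝ} (hx : ∀ c, 0 ≤ x c)
    (hchain : IsChain (· ≤ ·) (x.support : Set (OrderComplex P))) {c : OrderComplex P}
    (hc : IsGreatest (x.support : Set (OrderComplex P)) c) :
    IsLeast ((fun p => Finsupp.linearCombination ℝ barycenter x p) '' (c.carrier : Set P))
      (x c * (c.carrier.card : ℝ)⁻¹) := by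
  classical
  constructor
  -- The minimum is attained at a vertex of `c` outside all other members of the flag: these have a
  -- largest member, properly contained in `c`. Only `c` contributes to that coordinate.
  · obtain ⟨p, hp, hne⟩ : ∃ p ∈ c.carrier, ∀ d ∈ x.support, d ≠ c → p ∉ d.carrier := by
      by_cases h : (x.support.erase c).Nonempty
      · let C : OrderComplex (OrderComplex P) :=
          ⟨x.support.erase c, h, hchain.mono (by exact_mod_cast Finset.erase_subset _ _)⟩
        obtain ⟨hlne, hl⟩ := Finset.mem_erase.1 C.last_mem
        obtain ⟨p, hp, hp'⟩ := Finset.exists_of_ssubset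
          (lt_of_le_of_ne (hc.2 hl) hlne : C.last < c)
        exact ⟨p, hp, fun d hd hdc hpd =>
          hp' (C.le_last (Finset.mem_erase.2 ⟨hdc, hd⟩ : d ∈ C.carrier) hpd)⟩
      · obtain ⟨p, hp⟩ := c.nonempty
        exact ⟨p, hp, fun d hd hdc => absurd ⟨d, Finset.mem_erase.2 ⟨hdc, hd⟩⟩ h⟩
    refine ⟨p, hp, ?_⟩
    change Finsupp.linearCombination ℝ barycenter x p = _
    rw [linearCombination_barycenter_apply, Finset.sum_eq_single_of_mem c hc.1,
      barycenter_apply_of_mem hp]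
    intro d hd hdc
    rw [barycenter_apply_of_notMem (hne d hd hdc), mul_zero]
  · rintro _ ⟨p, hp, rfl⟩
    change _ ≤ Finsupp.linearCombination ℝ barycenter x p
    rw [linearCombination_barycenter_apply, ← barycenter_apply_of_mem hp]
    exact Finset.single_le_sum (f := fun d => x d * barycenter d p)
      (fun d _ => mul_nonneg (hx d) (barycenter_nonneg d p)) hc.1

/-- The combination determines the top simplex of the flag (its support) and the coefficient there
(its least coordinate on that simplex, times the number of vertices). Removing the top term gives
the induction; total weight one is not assumed since removal would destroy it. -/
theorem linearCombination_barycenter_injective (n : ℕ) : ∀ {x y : OrderComplex P →₀ ℝ},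
    (∀ c, 0 ≤ x c) → (∀ c, 0 ≤ y c) → IsChain (· ≤ ·) (x.support : Set (OrderComplex P)) →
    IsChain (· ≤ ·) (y.support : Set (OrderComplex P)) → x.support.card = n →
    Finsupp.linearCombination ℝ barycenter x = Finsupp.linearCombination ℝ barycenter y →
    x = y := by
  classical
  have hgreatest {x : OrderComplex P →₀ ℝ} (hx : ∀ c, 0 ≤ x c)
      (hcx : IsChain (· ≤ ·) (x.support : Set (OrderComplex P))) (h0 : x ≠ 0) :
      ∃ c, IsGreatest (x.support : Set (OrderComplex P)) c ∧
        c.carrier = (Finsupp.linearCombination ℝ barycenter x).support := by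
    let C : OrderComplex (OrderComplex P) := ⟨x.support, Finsupp.support_nonempty_iff.2 h0, hcx⟩
    refine ⟨C.last, C.isGreatest_last, ?_⟩
    ext p
    rw [mem_support_linearCombination_barycenter hx]
    exact ⟨fun hp => ⟨_, C.last_mem, hp⟩, fun ⟨c, hc, hp⟩ => C.le_last hc hp⟩
  have hzero {x y : OrderComplex P →₀ ℝ} (hy : ∀ c, 0 ≤ y c) (hx0 : x = 0)
      (h : Finsupp.linearCombination ℝ barycenter x = Finsupp.linearCombination ℝ barycenter y) :
      y = 0 := by
    by_contra h0
    obtain ⟨c, hc⟩ := Finsupp.support_nonempty_iff.2 h0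
    obtain ⟨p, hp⟩ := c.nonempty
    have := (mem_support_linearCombination_barycenter hy).2 ⟨c, hc, hp⟩
    rw [← h, hx0, map_zero] at this
    simp at this
  induction n with
  | zero =>
    intro x y hx hy _ _ hn h
    have hx0 : x = 0 := Finsupp.support_eq_empty.1 (Finset.card_eq_zero.1 hn)
    rw [hx0, hzero hy hx0 h]
  | succ n ih =>
    intro x y hx hy hcx hcy hn h
    have hx0 : x ≠ 0 := fun h0 => by simp [h0] at hn
    have hy0 : y ≠ 0 := fun h0 => hx0 (hzero hx h0 h.symm)
    obtain ⟨c, hc, hc'⟩ := hgreatest hx hcx hx0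
    obtain ⟨d, hd, hd'⟩ := hgreatest hy hcy hy0
    obtain rfl : c = d := OrderComplex.ext (by rw [hc', hd', h])
    have h1 := isLeast_linearCombination_barycenter hx hcx hc
    have h2 := isLeast_linearCombination_barycenter hy hcy hd
    rw [h] at h1
    have hxy : x c = y c := mul_right_cancel₀ (inv_card_pos c).ne' (h1.unique h2)
    have hsplit (z : OrderComplex P →₀ ℝ) : Finsupp.linearCombination ℝ barycenter (z.erase c)
        = Finsupp.linearCombination ℝ barycenter z - z c • barycenter c := by
      rw [← Finsupp.linearCombination_single ℝ (z c) c, ← map_sub, eq_comm]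
      congr 1
      exact sub_eq_of_eq_add (Finsupp.erase_add_single c z).symm
    have hnonneg {z : OrderComplex P →₀ ℝ} (hz : ∀ c, 0 ≤ z c) (d) : 0 ≤ z.erase c d := by
      rw [Finsupp.erase_apply]
      split_ifs
      exacts [le_rfl, hz d]
    have hsub (z : OrderComplex P →₀ ℝ) :
        ((z.erase c).support : Set (OrderComplex P)) ⊆ z.support := by
      rw [Finsupp.support_erase]
      exact_mod_cast Finset.erase_subset _ _
    have herase : x.erase c = y.erase c := by
      refine ih (hnonneg hx) (hnonneg hy) (hcx.mono (hsub x)) (hcy.mono (hsub y)) ?_ ?_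
      · rw [Finsupp.support_erase, Finset.card_erase_of_mem hc.1, hn, Nat.add_sub_cancel]
      · rw [hsplit, hsplit, h, hxy]
    rw [← Finsupp.erase_add_single c x, ← Finsupp.erase_add_single c y, herase, hxy]

/-- Greedy decomposition: subtract the largest multiple of the barycenter of the support that keeps
the coordinates nonnegative, and continue with the smaller support. The bound on the simplices used
is carried along so that the new top simplex contains all the others. -/
theorem exists_linearCombination_barycenter (w : P →₀ ℝ) (hw : ∀ p, 0 ≤ w p)
    (hchain : IsChain (· ≤ ·) (w.support : Set P)) :
    ∃ x : OrderComplex P →₀ ℝ, (∀ c, 0 ≤ x c) ∧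
      IsChain (· ≤ ·) (x.support : Set (OrderComplex P)) ∧
      (∀ c ∈ x.support, c.carrier ⊆ w.support) ∧ Finsupp.linearCombination ℝ barycenter x = w := by
  classical
  induction hn : w.support.card using Nat.strong_induction_on generalizing w with
  | _ n ih =>
    by_cases h0 : w = 0
    · subst h0
      exact ⟨0, fun _ => le_rfl, by simp, by simp, by simp⟩
    let c : OrderComplex P := ⟨w.support, Finsupp.support_nonempty_iff.2 h0, hchain⟩
    obtain ⟨p, hp, hmin⟩ := Finset.exists_min_image w.support w c.nonempty
    have hcard := (inv_card_pos c).ne'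
    have hcard' : (c.carrier.card : ℝ) ≠ 0 := fun h => hcard (by rw [h, inv_zero])
    -- With this factor `a • barycenter c` has the minimal value `w p` at every vertex of `c`, so
    -- the subtraction removes `p` from the support.
    let a : ℝ := w p * c.carrier.card
    have ha : 0 ≤ a := mul_nonneg (hw p) (Nat.cast_nonneg _)
    let w' : P →₀ ℝ := w - a • barycenter c
    have hw'mem {q} (hq : q ∈ w.support) : w' q = w q - w p := by
      change w q - a * barycenter c q = _
      rw [barycenter_apply_of_mem hq, mul_inv_cancel_right₀ hcard']
    have hw'notMem {q} (hq : q ∉ w.support) : w' q = 0 := by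
      change w q - a * barycenter c q = _
      rw [barycenter_apply_of_notMem hq, Finsupp.notMem_support_iff.1 hq, mul_zero, sub_zero]
    have hsub : w'.support ⊆ w.support := fun q hq =>
      by_contra fun h => Finsupp.mem_support_iff.1 hq (hw'notMem h)
    have hlt : w'.support.card < n := by
      rw [← hn]
      refine Finset.card_lt_card ⟨hsub, fun h => ?_⟩
      exact Finsupp.mem_support_iff.1 (h hp) (by rw [hw'mem hp, sub_self])
    obtain ⟨x, hx, hcx, hxs, hxw⟩ := ih _ hlt w' (fun q => by
      by_cases hq : q ∈ w.support
      · rw [hw'mem hq]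
        exact sub_nonneg.2 (hmin q hq)
      · rw [hw'notMem hq]) (hchain.mono hsub) rfl
    have hmem {d} (hd : d ∈ (x + Finsupp.single c a).support) : d ∈ x.support ∨ d = c :=
      (Finset.mem_union.1 (Finsupp.support_add hd)).imp_right fun h =>
        Finset.mem_singleton.1 (Finsupp.support_single_subset h)
    have hle {d} (hd : d ∈ x.support) : d ≤ c := (hxs d hd).trans hsub
    refine ⟨x + Finsupp.single c a, fun d => ?_, ?_, fun d hd => ?_, ?_⟩
    · rw [Finsupp.add_apply, Finsupp.single_apply]
      split_ifs
      exacts [add_nonneg (hx d) ha, add_nonneg (hx d) le_rfl]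
    · intro d hd e he _
      rcases hmem hd with hd | rfl <;> rcases hmem he with he | rfl
      · exact hcx.total hd he
      · exact Or.inl (hle hd)
      · exact Or.inr (hle he)
      · exact Or.inl le_rfl
    · rcases hmem hd with hd | rfl
      exacts [hle hd, subset_rfl]
    · rw [map_add, hxw, Finsupp.linearCombination_single]
      exact sub_add_cancel _ _

/-- The barycenter of a simplex, as a point of the realization. -/
noncomputable def barycenterPoint (c : OrderComplex P) : Realization P where
  weight := barycenter c
  nonneg := barycenter_nonneg c
  sum_eq_one := (sum_eq_linearCombination_one _).trans (barycenter_sum c)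
  isChain := c.isChain.mono fun _ => mem_of_mem_support_barycenter c

theorem isCarried_barycenterPoint : IsCarried (barycenterPoint : OrderComplex P → Realization P) :=
  fun C => ⟨C.last, fun _ hc _ hp => C.le_last hc (mem_of_mem_support_barycenter _ hp)⟩

theorem continuous_subdivision :
    Continuous (subdivision : Realization (OrderComplex P) → Realization P) :=
  continuous_affineFun barycenterPoint isCarried_barycenterPoint

theorem bijective_subdivision :
    Function.Bijective (subdivision : Realization (OrderComplex P) → Realization P) := by
  constructor
  · intro x y h
    exact Realization.ext (linearCombination_barycenter_injective _ x.nonneg y.nonneg x.isChain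
      y.isChain rfl (congrArg weight h))
  · intro w
    obtain ⟨x, hx, hcx, -, hxw⟩ := exists_linearCombination_barycenter w.weight w.nonneg w.isChain
    refine ⟨⟨x, hx, ?_, hcx⟩, Realization.ext hxw⟩
    -- Each barycenter has total weight one, so the coefficients sum to the total weight of `w`.
    rw [← w.sum_eq_one, ← hxw, sum_eq_linearCombination_one, sum_eq_linearCombination_one,
      Finsupp.apply_linearCombination]
    congr 1
    exact congrArg _ (funext fun c => (barycenter_sum c).symm)

/-- A point mapped into the simplex `d` is supported on a flag of faces of `d`. There are finitely
many such flags, and each contributes the image of a compact set, which is closed; so the trace of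
the image on `d` is closed. -/
theorem isClosedMap_subdivision :
    IsClosedMap (subdivision : Realization (OrderComplex P) → Realization P) := by
  intro A hA
  refine isClosed_iff_preimage_face.2 fun d => ?_
  let s : Set (OrderComplex P) := {c | (c.carrier : Set P) ⊆ d.carrier}
  let T : Set (OrderComplex (OrderComplex P)) := {C | (C.carrier : Set (OrderComplex P)) ⊆ s}
  have hT : T.Finite := OrderComplex.finite_setOf_carrier_subset
    (OrderComplex.finite_setOf_carrier_subset d.carrier.finite_toSet)
  have hcompact (C : OrderComplex (OrderComplex P)) :
      IsCompact (subdivision '' (face C '' (face C ⁻¹' A))) :=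
    ((hA.preimage (continuous_face C)).isCompact.image (continuous_face C)).image
      continuous_subdivision
  have hclosed : IsClosed (⋃ C ∈ T, subdivision '' (face C '' (face C ⁻¹' A))) :=
    hT.isClosed_biUnion fun C _ => (hcompact C).isClosed
  convert hclosed.preimage (continuous_face d) using 1
  ext z
  simp only [Set.mem_preimage, Set.mem_iUnion]
  constructor
  · rintro ⟨a, ha, haz⟩
    refine ⟨a.carrierSimplex, fun c hc p hp => face_support_subset d z ?_, a,
      ⟨coordsIn _ a a.support_subset_carrierSimplex, ?_, face_coordsIn _ a _⟩, haz⟩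
    · rw [← haz]
      exact (mem_support_linearCombination_barycenter a.nonneg).2 ⟨c, hc, hp⟩
    · rwa [Set.mem_preimage, face_coordsIn]
  · rintro ⟨C, _, _, ⟨y, hy, rfl⟩, h⟩
    exact ⟨_, hy, h⟩

/-- Barycentric subdivision is a homeomorphism `|Δ P| ≃ₜ |P|`. -/
noncomputable def subdivisionHomeomorph (P : Type*) [PartialOrder P] :
    Realization (OrderComplex P) ≃ₜ Realization P :=
  (Equiv.ofBijective subdivision bijective_subdivision).toHomeomorphOfContinuousClosed
    continuous_subdivision isClosedMap_subdivision

/-- Barycentric subdivision `|Δ P| → |P|` as a continuous map. -/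
noncomputable def sd (P : Type*) [PartialOrder P] :
    C(Realization (OrderComplex P), Realization P) :=
  (subdivisionHomeomorph P : C(Realization (OrderComplex P), Realization P))

/-- The inverse `|P| → |Δ P|` of the barycentric subdivision. -/
noncomputable def sdInv (P : Type*) [PartialOrder P] :
    C(Realization P, Realization (OrderComplex P)) :=
  ((subdivisionHomeomorph P).symm : C(Realization P, Realization (OrderComplex P)))

theorem sd_comp_sdInv : (sd P).comp (sdInv P) = ContinuousMap.id _ :=
  ContinuousMap.ext (subdivisionHomeomorph P).apply_symm_apply

theorem sdInv_comp_sd : (sdInv P).comp (sd P) = ContinuousMap.id _ :=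
  ContinuousMap.ext (subdivisionHomeomorph P).symm_apply_apply

section Equivariance

variable {G : Type*} [Group G] [MulAction G P] [IsGPoset G P] [MulAction G Q] [IsGPoset G Q]

theorem isEquivariant_barycenterPoint :
    IsEquivariant G (barycenterPoint : OrderComplex P → Realization P) := by
  intro g c
  apply Realization.ext
  change barycenter (g • c) = (barycenter c).mapDomain fun p => g • p
  have hcard : (g • c).carrier.card = c.carrier.card := Finset.card_map _
  rw [barycenter, barycenter, Finsupp.mapDomain_finsetSum, hcard]
  refine (Finset.sum_map _ _ _).trans (Finset.sum_congr rfl fun p _ => ?_)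
  rw [Finsupp.mapDomain_single]
  rfl

theorem isEquivariant_sd : IsEquivariant G (sd P) :=
  isEquivariant_affine isCarried_barycenterPoint isEquivariant_barycenterPoint

theorem isEquivariant_sdInv : IsEquivariant G (sdInv P) := by
  intro g x
  apply (subdivisionHomeomorph P).injective
  change (sd P).comp (sdInv P) (g • x) = sd P (g • sdInv P x)
  rw [isEquivariant_sd g]
  change (sd P).comp (sdInv P) (g • x) = g • (sd P).comp (sdInv P) x
  rw [sd_comp_sdInv]
  rfl

end Equivariance

end Realization

end CommonBasis

/-! ### Homotopies from comparable maps, and cancellation of subdivisions -/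

namespace CommonBasis

open OrderComplex

namespace Realization

variable {P : Type*} [PartialOrder P] {Q : Type*} [PartialOrder Q]

/-! ### Homotopies between realizations of order-preserving maps -/

/-- A vertex of the realization. -/
noncomputable def vertex (p : P) : Realization P where
  weight := Finsupp.single p 1
  nonneg q := by
    classical
    rw [Finsupp.single_apply]
    split_ifs
    exacts [zero_le_one, le_rfl]
  sum_eq_one := by simp
  isChain := (IsChain.singleton (a := p)).mono fun q hq =>
    Finset.mem_singleton.1 (Finsupp.support_single_subset hq)

theorem vertex_support_subset {p : P} {d : Finset P} (hp : p ∈ d) :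
    (vertex p).weight.support ⊆ d :=
  Finsupp.support_single_subset.trans (Finset.singleton_subset_iff.2 hp)

/-- The first vertex reverses the order on `OrderComplex P`, so it is not realized by `map`; the
affine extension of a carried vertex map takes its place. -/
theorem isCarried_vertex_first :
    IsCarried fun c : OrderComplex P => vertex c.first :=
  fun C => ⟨C.last, fun c hc => vertex_support_subset (C.le_last hc c.first_mem)⟩

/-- The affine map `|Δ P| → |P|` that sends a chain to its smallest element. -/
noncomputable def firstMap (P : Type*) [PartialOrder P] :
    C(Realization (OrderComplex P), Realization P) :=
  affine (fun c => vertex c.first) isCarried_vertex_first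

theorem sd_support_subset {C : OrderComplex (OrderComplex P)} {x : Realization (OrderComplex P)}
    (hx : x.weight.support ⊆ C.carrier) : (sd P x).weight.support ⊆ C.last.carrier :=
  affine_support_subset isCarried_barycenterPoint
    (fun _ hc _ hp => C.le_last hc (mem_of_mem_support_barycenter _ hp)) hx

theorem firstMap_support_subset {C : Finset (OrderComplex P)} {d : Finset P}
    (hd : ∀ c ∈ C, c.first ∈ d) {x : Realization (OrderComplex P)}
    (hx : x.weight.support ⊆ C) : (firstMap P x).weight.support ⊆ d :=
  affine_support_subset isCarried_vertex_first (fun c hc => vertex_support_subset (hd c hc)) hx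

theorem contiguous_sd_map_last : Contiguous (sd P) (map (lastHom P)) :=
  fun C => ⟨C.last, fun _ hx => ⟨sd_support_subset hx,
    map_support_subset (lastHom P) (fun c hc => C.le_last hc c.last_mem) hx⟩⟩

theorem contiguous_sd_firstMap : Contiguous (sd P) (firstMap P) :=
  fun C => ⟨C.last, fun _ hx => ⟨sd_support_subset hx,
    firstMap_support_subset (fun c hc => C.le_last hc c.first_mem) hx⟩⟩

/-- Any two members of a flag are nested, so the first vertex of either lies below the last vertex
of the other. Hence all values of `f` at first vertices lie below all values of `f'` at last
vertices, and together they form a chain. -/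
theorem contiguous_first_last {f f' : P →o Q} (h : f ≤ f') :
    Contiguous ((map f).comp (firstMap P)) ((map f').comp (map (lastHom P))) := by
  classical
  intro C
  have hcomp {c d : OrderComplex P} (hc : c ∈ C.carrier) (hd : d ∈ C.carrier) :
      f c.first ≤ f' d.last := by
    refine (f.monotone ?_).trans (h _)
    rcases C.isChain.total hc hd with hcd | hcd
    · exact c.first_le c.last_mem |>.trans (d.le_last (hcd c.last_mem))
    · exact c.first_le (hcd d.last_mem)
  let D : OrderComplex Q :=
    { carrier := C.carrier.image (fun c => f c.first) ∪ C.carrier.image (fun c => f' c.last)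
      nonempty := (C.nonempty.image _).inl
      isChain := by
        intro p hp q hq _
        simp only [Finset.coe_union, Finset.coe_image, Set.mem_union, Set.mem_image,
          Finset.mem_coe] at hp hq
        obtain ⟨c, hc, rfl⟩ | ⟨c, hc, rfl⟩ := hp <;> obtain ⟨d, hd, rfl⟩ | ⟨d, hd, rfl⟩ := hq
        · exact (C.isChain.total hd hc).imp (fun h => f.monotone (c.first_le (h d.first_mem)))
            fun h => f.monotone (d.first_le (h c.first_mem))
        · exact Or.inl (hcomp hc hd)
        · exact Or.inr (hcomp hd hc)
        · exact (C.isChain.total hc hd).imp (fun h => f'.monotone (d.le_last (h c.last_mem)))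
            fun h => f'.monotone (c.le_last (h d.last_mem)) }
  refine ⟨D, fun x hx => ⟨?_, ?_⟩⟩
  · refine map_support_subset f (c := C.carrier.image first) (fun p hp => ?_)
      (firstMap_support_subset (fun c hc => Finset.mem_image_of_mem _ hc) hx)
    obtain ⟨c, hc, rfl⟩ := Finset.mem_image.1 hp
    exact Finset.mem_union_left _ (Finset.mem_image_of_mem (fun c => f c.first) hc)
  · refine map_support_subset f' (c := C.carrier.image last) (fun p hp => ?_)
      (map_support_subset (lastHom P) (fun c hc => Finset.mem_image_of_mem _ hc) hx)
    obtain ⟨c, hc, rfl⟩ := Finset.mem_image.1 hp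
    exact Finset.mem_union_right _ (Finset.mem_image_of_mem (fun c => f' c.last) hc)

section Equivariance

variable {G : Type*} [Group G] [MulAction G P] [IsGPoset G P] [MulAction G Q] [IsGPoset G Q]

theorem isEquivariant_firstMap : IsEquivariant G (firstMap P) := by
  refine isEquivariant_affine isCarried_vertex_first fun g c => ?_
  apply Realization.ext
  change Finsupp.single (g • c).first 1 = (Finsupp.single c.first (1 : ℝ)).mapDomain _
  rw [Finsupp.mapDomain_single, isEquivariant_first g c]
  rfl

theorem gHomotopic_sd_map_last : GHomotopic G (sd P) (map (lastHom P)) :=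
  contiguous_sd_map_last.gHomotopic isEquivariant_sd (isEquivariant_map isEquivariant_last)

/-- Precomposition with the equivariant inverse `sdInv` cancels `sd`. -/
theorem gHomotopic_of_comp_sd {f f' : C(Realization P, Realization Q)}
    (h : GHomotopic G (f.comp (sd P)) (f'.comp (sd P))) : GHomotopic G f f' := by
  have := h.comp_right (isEquivariant_sdInv (G := G) (P := P))
  rwa [ContinuousMap.comp_assoc, ContinuousMap.comp_assoc, sd_comp_sdInv, ContinuousMap.comp_id,
    ContinuousMap.comp_id] at this

/-- Comparable equivariant order-preserving maps have `G`-homotopic realizations. -/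
theorem gHomotopic_map_of_le {f f' : P →o Q} (h : f ≤ f') (hf : IsEquivariant G f)
    (hf' : IsEquivariant G f') : GHomotopic G (map f) (map f') := by
  -- Subdividing is needed: for `p < q` the values `f q` and `f' p` may be incomparable, so `map f`
  -- and `map f'` need not be contiguous. After `sd`, first and last vertices interpolate between
  -- them.
  apply gHomotopic_of_comp_sd
  have hmf := isEquivariant_map hf
  have hmf' := isEquivariant_map hf'
  have h1 : GHomotopic G ((map f).comp (sd P)) ((map f).comp (firstMap P)) :=
    (contiguous_sd_firstMap.gHomotopic isEquivariant_sd isEquivariant_firstMap).comp_left hmf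
  have h2 : GHomotopic G ((map f).comp (firstMap P)) ((map f').comp (map (lastHom P))) :=
    (contiguous_first_last h).gHomotopic (hmf.comp isEquivariant_firstMap)
      (hmf'.comp (isEquivariant_map isEquivariant_last))
  exact (h1.trans h2).trans (gHomotopic_sd_map_last.comp_left hmf').symm

/-- Barycentric subdivision is natural up to `G`-homotopy. -/
theorem gHomotopic_map_comp_sd {f : P →o Q} (hf : IsEquivariant G f) :
    GHomotopic G ((map f).comp (sd P)) ((sd Q).comp (map (mapHom f))) := by
  have h1 : GHomotopic G ((map f).comp (sd P)) ((map f).comp (map (lastHom P))) :=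
    gHomotopic_sd_map_last.comp_left (isEquivariant_map hf)
  have h2 : GHomotopic G ((sd Q).comp (map (mapHom f))) ((map (lastHom Q)).comp (map (mapHom f))) :=
    gHomotopic_sd_map_last.comp_right (isEquivariant_map (isEquivariant_mapHom hf))
  -- Unlike `sd`, the last-vertex map is strictly natural, even when `f` is not injective.
  have h3 : f.comp (lastHom P) = (lastHom Q).comp (mapHom f) :=
    OrderHom.ext _ _ (funext fun c => (last_mapHom f c).symm)
  rw [← map_comp, h3, map_comp] at h1
  exact h1.trans h2.symm

/-- The map `|P| → |Q|` given by an order-preserving map `Δ P → Q`. -/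
noncomputable def ofSubdivision (f : OrderComplex P →o Q) : C(Realization P, Realization Q) :=
  (map f).comp (sdInv P)

theorem ofSubdivision_comp_sd (f : OrderComplex P →o Q) :
    (ofSubdivision f).comp (sd P) = map f := by
  rw [ofSubdivision, ContinuousMap.comp_assoc, sdInv_comp_sd, ContinuousMap.comp_id]

theorem isEquivariant_ofSubdivision {f : OrderComplex P →o Q} (hf : IsEquivariant G f) :
    IsEquivariant G (ofSubdivision f) :=
  (isEquivariant_map hf).comp isEquivariant_sdInv

/-- This reduces the homotopy to a comparison of order-preserving maps on the second order complex:
precomposed with two subdivisions, the left side becomes `map (f'.comp (mapHom f))` by naturality of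
`sd`, and the identity becomes the iterated last-vertex map. -/
theorem gHomotopic_ofSubdivision_comp {f : OrderComplex P →o Q} {f' : OrderComplex Q →o P}
    (hf : IsEquivariant G f) (hf' : IsEquivariant G f')
    (h : GHomotopic G (map (f'.comp (mapHom f)))
      (map ((lastHom P).comp (lastHom (OrderComplex P))))) :
    GHomotopic G ((ofSubdivision f').comp (ofSubdivision f)) (ContinuousMap.id _) := by
  apply gHomotopic_of_comp_sd
  apply gHomotopic_of_comp_sd
  rw [ContinuousMap.comp_assoc (ofSubdivision f'), ofSubdivision_comp_sd, ContinuousMap.id_comp]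
  have h1 : GHomotopic G (((ofSubdivision f').comp (map f)).comp (sd (OrderComplex P)))
      (((ofSubdivision f').comp (sd Q)).comp (map (mapHom f))) := by
    rw [ContinuousMap.comp_assoc, ContinuousMap.comp_assoc]
    exact (gHomotopic_map_comp_sd hf).comp_left (isEquivariant_ofSubdivision hf')
  rw [ofSubdivision_comp_sd, ← map_comp] at h1
  have h2 : GHomotopic G ((sd P).comp (sd (OrderComplex P)))
      ((map (lastHom P)).comp (map (lastHom (OrderComplex P)))) :=
    (gHomotopic_sd_map_last.comp_right isEquivariant_sd).trans
      (gHomotopic_sd_map_last.comp_left (isEquivariant_map isEquivariant_last))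
  rw [← map_comp] at h2
  exact (h1.trans h).trans h2.symm

theorem isGHomotopyInverse_comp_sd {f : C(Realization P, Realization Q)}
    {f' : C(Realization Q, Realization P)} (h : IsGHomotopyInverse G f f') :
    IsGHomotopyInverse G (f.comp (sd P)) ((sdInv P).comp f') where
  equivariant := h.equivariant.comp isEquivariant_sd
  equivariant' := isEquivariant_sdInv.comp h.equivariant'
  left_inv := by
    have := (h.left_inv.comp_right (isEquivariant_sd (G := G) (P := P))).comp_left
      (isEquivariant_sdInv (G := G) (P := P))
    rw [ContinuousMap.id_comp, sdInv_comp_sd] at this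
    exact this
  right_inv := by
    have : (f.comp (sd P)).comp ((sdInv P).comp f') = f.comp f' := by
      rw [ContinuousMap.comp_assoc, ← ContinuousMap.comp_assoc (sd P), sd_comp_sdInv,
        ContinuousMap.id_comp]
    rw [this]
    exact h.right_inv

theorem _root_.CommonBasis.IsGHomotopyInverse.symm {X Y : Type*} [TopologicalSpace X]
    [TopologicalSpace Y] [MulAction G X] [MulAction G Y] {f : C(X, Y)} {f' : C(Y, X)}
    (h : IsGHomotopyInverse G f f') : IsGHomotopyInverse G f' f :=
  ⟨h.equivariant', h.equivariant, h.right_inv, h.left_inv⟩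

end Equivariance

end Realization

end CommonBasis

/-! ### Frames, closures and the maps between CB and PD -/

namespace CommonBasis

open scoped Pointwise
open OrderComplex

/-- To show that a construction on sets commutes with the action, one inclusion is enough. -/
theorem smul_set_eq_of_subset {G S : Type*} [Group G] [MulAction G S] {f : Set S → Set S}
    (h : ∀ (g : G) (σ : Set S), g • f σ ⊆ f (g • σ))
    (g : G) (σ : Set S) : f (g • σ) = g • f σ := by
  -- The reverse inclusion is the hypothesis for `g⁻¹` and `g • σ`.
  refine (Set.subset_smul_set_iff.2 ?_).antisymm (h g σ)
  simpa using h g⁻¹ (g • σ)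

section Frames

variable {S : Type*} [PartialOrder S]

/-- Each of the finitely many subsets of `τ` has at most one join. This makes basis compatible sets
finite, which supplies the minimal and maximal elements needed for $m$. -/
theorem IsFrame.finite_joinSpan {τ : Set S} (hτ : IsFrame τ) : (joinSpan τ).Finite := by
  refine (hτ.finite.finite_subsets.biUnion (t := fun α => {z | IsLUB α z}) fun α _ =>
    Set.Subsingleton.finite fun x hx y hy => IsLUB.unique hx hy).subset ?_
  rintro z ⟨α, hα, -, hz⟩
  exact Set.mem_biUnion (x := α) hα hz

theorem subset_joinSpan (τ : Set S) : τ ⊆ joinSpan τ := fun x hx =>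
  ⟨{x}, Set.singleton_subset_iff.2 hx, Set.singleton_nonempty x, isLUB_singleton⟩

/-- A join of joins of elements of `τ` is a join of elements of `τ`. -/
theorem joinSpan_subset_of_subset {ρ τ : Set S} (h : ρ ⊆ joinSpan τ) :
    joinSpan ρ ⊆ joinSpan τ := by
  rintro z ⟨α, hα, ⟨a, ha⟩, hz⟩
  -- Taking everything in `τ` below some member of `α` avoids choosing a representing subset for
  -- each member and has the same join.
  refine ⟨{t ∈ τ | ∃ a ∈ α, t ≤ a}, fun t ht => ht.1, ?_, ?_, fun b hb => hz.2 fun a ha => ?_⟩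
  · obtain ⟨β, hβ, ⟨b, hb⟩, hab⟩ := h (hα ha)
    exact ⟨b, hβ hb, a, ha, hab.1 hb⟩
  · rintro t ⟨-, a, ha, hta⟩
    exact hta.trans (hz.1 ha)
  · obtain ⟨β, hβ, -, hab⟩ := h (hα ha)
    exact hab.2 fun t ht => hb ⟨hβ ht, a, ha, hab.1 ht⟩

theorem subset_meetClosure (σ : Set S) : σ ⊆ meetClosure σ := fun x hx =>
  ⟨{x}, Set.singleton_subset_iff.2 hx, Set.singleton_nonempty x, isGLB_singleton⟩

theorem meetClosure_mono {σ σ' : Set S} (h : σ ⊆ σ') : meetClosure σ ⊆ meetClosure σ' := by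
  rintro z ⟨α, hα, hne, hz⟩
  exact ⟨α, hα.trans h, hne, hz⟩

theorem exists_le_of_mem_meetClosure {σ : Set S} {z : S} (hz : z ∈ meetClosure σ) :
    ∃ y ∈ σ, z ≤ y := by
  obtain ⟨α, hα, ⟨a, ha⟩, h⟩ := hz
  exact ⟨a, hα ha, h.1 ha⟩

/-- A meet that exists is itself a lower bound, so the frame axiom applies and, by uniqueness of
meets, places it in `joinSpan τ`. -/
theorem IsFrame.meetClosure_subset {τ σ : Set S} (hτ : IsFrame τ) (h : P₁ σ τ) :
    P₁ (meetClosure σ) τ := by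
  rintro z ⟨α, hα, hne, hz⟩
  obtain ⟨w, hw, hw'⟩ := hτ.exists_meet α (fun y hy => h y (hα hy)) hne ⟨z, hz.1⟩
  rwa [hz.unique hw']

/-- Two elements of `Cl(σ)` with a common lower bound have a meet in `Cl(σ)`. -/
theorem IsFrame.exists_isGLB_mem_meetClosure {τ σ : Set S} (hτ : IsFrame τ) (h : P₁ σ τ)
    {x y t : S} (hx : x ∈ meetClosure σ) (hy : y ∈ meetClosure σ) (htx : t ≤ x) (hty : t ≤ y) :
    ∃ z ∈ meetClosure σ, z ≤ x ∧ z ≤ y := by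
  obtain ⟨α, hα, hne, hx⟩ := hx
  obtain ⟨β, hβ, -, hy⟩ := hy
  have hσ : α ∪ β ⊆ σ := Set.union_subset hα hβ
  obtain ⟨w, -, hw⟩ := hτ.exists_meet (α ∪ β) (fun a ha => h a (hσ ha)) hne.inl
    ⟨t, by rintro a (ha | ha); exacts [htx.trans (hx.1 ha), hty.trans (hy.1 ha)]⟩
  exact ⟨w, ⟨_, hσ, hne.inl, hw⟩, hx.2 fun a ha => hw.1 (Or.inl ha),
    hy.2 fun a ha => hw.1 (Or.inr ha)⟩

section Action

variable {G : Type*} [Group G] [MulAction G S] [IsGPoset G S]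

theorem smul_le_iff_le_inv_smul (g : G) {x y : S} : g • x ≤ y ↔ x ≤ g⁻¹ • y := by
  rw [← smul_le_smul_iff' g (y := g⁻¹ • y), smul_inv_smul]

theorem isGLB_smul (g : G) {α : Set S} {z : S} (h : IsGLB α z) : IsGLB (g • α) (g • z) := by
  constructor
  · rintro _ ⟨a, ha, rfl⟩
    exact IsGPoset.smul_le_smul g (h.1 ha)
  · intro b hb
    rw [← inv_inv g, ← smul_le_iff_le_inv_smul]
    refine h.2 fun a ha => ?_
    rw [smul_le_iff_le_inv_smul, inv_inv]
    exact hb (Set.smul_mem_smul_set ha)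

theorem meetClosure_smul (g : G) (σ : Set S) : meetClosure (g • σ) = g • meetClosure σ := by
  refine smul_set_eq_of_subset (fun g σ => ?_) g σ
  rintro _ ⟨z, ⟨α, hα, hne, hz⟩, rfl⟩
  exact ⟨g • α, Set.smul_set_mono hα, hne.smul_set, isGLB_smul g hz⟩

theorem minSet_smul (g : G) (π : Set S) : minSet (g • π) = g • minSet π := by
  refine smul_set_eq_of_subset (fun g π => ?_) g π
  rintro _ ⟨z, hz, rfl⟩
  refine ⟨Set.smul_mem_smul_set hz.1, ?_⟩
  rintro _ ⟨y, hy, rfl⟩ hyz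
  exact IsGPoset.smul_le_smul g (hz.2 hy ((smul_le_smul_iff' g).1 hyz))

theorem maxSet_smul (g : G) (π : Set S) : maxSet (g • π) = g • maxSet π := by
  refine smul_set_eq_of_subset (fun g π => ?_) g π
  rintro _ ⟨z, hz, rfl⟩
  refine ⟨Set.smul_mem_smul_set hz.1, ?_⟩
  rintro _ ⟨y, hy, rfl⟩ hyz
  exact IsGPoset.smul_le_smul g (hz.2 hy ((smul_le_smul_iff' g).1 hyz))

end Action

end Frames

namespace FrameFamily

variable {S : Type*} [PartialOrder S] {F : FrameFamily S}

/-! ### From chains of basis compatible sets to partial decompositions -/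

/-- `Cl(σ)` as an element of the common basis complex. -/
def CB.meetClosure (σ : F.CB) : F.CB where
  carrier := CommonBasis.meetClosure σ.carrier
  nonempty := σ.nonempty.mono (subset_meetClosure _)
  compatible := by
    obtain ⟨τ, hτ, h⟩ := σ.compatible
    exact ⟨τ, hτ, (F.isFrame τ hτ).meetClosure_subset h⟩

/-- `Cl` as an order-preserving map. -/
def CB.meetClosureHom (F : FrameFamily S) : F.CB →o F.CB where
  toFun := CB.meetClosure
  monotone' _ _ h := meetClosure_mono h

theorem CB.le_meetClosure (σ : F.CB) : σ ≤ σ.meetClosure := subset_meetClosure _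

theorem CB.finite_carrier (σ : F.CB) : σ.carrier.Finite := by
  obtain ⟨τ, hτ, h⟩ := σ.compatible
  exact (F.isFrame τ hτ).finite_joinSpan.subset h

/-- The union of the sets `min(Cl(σ))` over a chain of basis compatible sets. -/
def minUnion (c : OrderComplex F.CB) : Set S :=
  ⋃ σ ∈ c.carrier, minSet (CommonBasis.meetClosure σ.carrier)

theorem mem_minUnion {c : OrderComplex F.CB} {x : S} :
    x ∈ minUnion c ↔ ∃ σ ∈ c.carrier, x ∈ minSet (CommonBasis.meetClosure σ.carrier) := by
  simp [minUnion]

theorem minUnion_subset (c : OrderComplex F.CB) : minUnion c ⊆ c.last.meetClosure.carrier := by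
  intro x hx
  obtain ⟨σ, hσ, hx⟩ := mem_minUnion.1 hx
  exact meetClosure_mono (c.le_last hσ) hx.1

theorem exists_le_mem_maxSet_minUnion {c : OrderComplex F.CB} {x : S} (hx : x ∈ minUnion c) :
    ∃ y ∈ maxSet (minUnion c), x ≤ y := by
  obtain ⟨y, hxy, hy⟩ :=
    (c.last.meetClosure.finite_carrier.subset (minUnion_subset c)).exists_le_maximal hx
  exact ⟨y, hy, hxy⟩

theorem minUnion_nonempty (c : OrderComplex F.CB) : (minUnion c).Nonempty := by
  obtain ⟨z, hz⟩ := c.last.meetClosure.nonempty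
  obtain ⟨y, -, hy⟩ := c.last.meetClosure.finite_carrier.exists_le_minimal hz
  exact ⟨y, mem_minUnion.2 ⟨_, c.last_mem, hy⟩⟩

/-- A frame for the largest member of `c` also serves all closures. For $P_2$, let `x` and `y` have
a common lower bound, with `x` minimal in $\mathrm{Cl}(\sigma)$, `y` minimal in
$\mathrm{Cl}(\sigma')$ and $\sigma\subseteq\sigma'$. Some `z` in $\mathrm{Cl}(\sigma')$ lies below
both; minimality of `y` gives $y\le z\le x$, and maximality of `y` in the union gives equality. -/
theorem isPartialDecomposition_maxSet_minUnion (c : OrderComplex F.CB) :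
    F.IsPartialDecomposition (maxSet (minUnion c)) := by
  obtain ⟨τ, hτ, h⟩ := c.last.compatible
  have hframe := F.isFrame τ hτ
  have key : ∀ t x y : S, x ∈ maxSet (minUnion c) → y ∈ maxSet (minUnion c) → t ≤ x → t ≤ y →
      ∀ σ ∈ c.carrier, ∀ σ' ∈ c.carrier, x ∈ minSet (meetClosure σ.carrier) →
      y ∈ minSet (meetClosure σ'.carrier) → σ ≤ σ' → x = y := by
    intro t x y hx hy htx hty σ hσ σ' hσ' hxσ hyσ' hσσ'
    obtain ⟨z, hz, hzx, hzy⟩ := hframe.exists_isGLB_mem_meetClosure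
      (fun a ha => h a (c.le_last hσ' ha)) (meetClosure_mono hσσ' hxσ.1) hyσ'.1 htx hty
    have hyx : y ≤ x := (hyσ'.2 hz hzy).trans hzx
    exact (hy.2 hx.1 hyx).antisymm hyx
  refine ⟨τ, hτ, fun y hy => ?_, fun t _ x hx y hy htx hty => ?_⟩
  · exact hframe.meetClosure_subset h _ (minUnion_subset c hy.1)
  · obtain ⟨σ, hσ, hxσ⟩ := mem_minUnion.1 hx.1
    obtain ⟨σ', hσ', hyσ'⟩ := mem_minUnion.1 hy.1
    rcases c.isChain.total hσ hσ' with hle | hle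
    · exact key t x y hx hy htx hty σ hσ σ' hσ' hxσ hyσ' hle
    · exact (key t y x hy hx hty htx σ' hσ' σ hσ hyσ' hxσ hle).symm

/-- The map `m : Δ CB → PD`. -/
def toPD (F : FrameFamily S) : OrderComplex F.CB →o F.PD where
  toFun c :=
    { carrier := maxSet (minUnion c)
      nonempty := by
        obtain ⟨x, hx⟩ := minUnion_nonempty c
        obtain ⟨y, hy, -⟩ := exists_le_mem_maxSet_minUnion hx
        exact ⟨y, hy⟩
      isPartialDecomposition := isPartialDecomposition_maxSet_minUnion c }
  -- A longer chain has a larger union, and by finiteness each of its elements lies below a maximal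
  -- one.
  monotone' c d h x hx := by
    obtain ⟨σ, hσ, hxσ⟩ := mem_minUnion.1 hx.1
    exact exists_le_mem_maxSet_minUnion (mem_minUnion.2 ⟨σ, h hσ, hxσ⟩)

/-! ### From chains of partial decompositions to basis compatible sets -/

/-- The extension property for pairs implies the extension property for chains. -/
theorem EP.exists_frame (hEP : F.EP) (c : OrderComplex F.PD) :
    ∃ τ ∈ F.frames, ∀ σ ∈ c.carrier, P₁ σ.carrier τ := by
  classical
  induction hn : c.carrier.card using Nat.strong_induction_on generalizing c with
  | _ n ih =>
    by_cases hne : (c.carrier.erase c.last).Nonempty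
    · let d : OrderComplex F.PD := ⟨c.carrier.erase c.last, hne,
        c.isChain.mono (by exact_mod_cast Finset.erase_subset _ _)⟩
      obtain ⟨τ, hτ, h⟩ := ih _ (by
        rw [← hn]
        exact Finset.card_erase_lt_of_mem c.last_mem) d rfl
      -- `ρ` compresses the shorter chain `d` into one partial decomposition: it generates every
      -- member of `d`, satisfies $P_2$ as part of the antichain `τ`, and refines `d.last`, hence
      -- `c.last`. A frame given by (EP) for `ρ` and `c.last` generates the whole chain, since joins
      -- of joins are joins.
      let ρ : Set S := {t ∈ τ | ∃ y ∈ d.last.carrier, t ≤ y}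
      have hρ : ∀ σ ∈ d.carrier, P₁ σ.carrier ρ := by
        intro σ hσ y hy
        obtain ⟨α, hα, hαne, hαy⟩ := h σ hσ y hy
        obtain ⟨z, hz, hyz⟩ := d.le_last hσ y hy
        exact ⟨α, fun t ht => ⟨hα ht, z, hz, (hαy.1 ht).trans hyz⟩, hαne, hαy⟩
      have hρne : ρ.Nonempty := by
        obtain ⟨y, hy⟩ := d.last.nonempty
        obtain ⟨α, hα, ⟨t, ht⟩, -⟩ := hρ _ d.last_mem y hy
        exact ⟨t, hα ht⟩
      have hanti := (F.isFrame τ hτ).antichain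
      let ρ' : F.PD := ⟨ρ, hρne, τ, hτ, fun t ht => subset_joinSpan τ ht.1,
        fun x hx y hy y' hy' hxy hxy' =>
          (hanti.eq hx hy.1 hxy).symm.trans (hanti.eq hx hy'.1 hxy')⟩
      have hle : ρ' ≤ c.last := le_trans (b := d.last) (fun t ht => ht.2)
        (c.le_last (Finset.mem_of_mem_erase d.last_mem))
      obtain ⟨τ', hτ', h1, h2⟩ := hEP ρ' c.last hle
      refine ⟨τ', hτ', fun σ hσ => ?_⟩
      by_cases hσl : σ = c.last
      · rwa [hσl]
      · exact fun y hy => joinSpan_subset_of_subset h1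
          (hρ σ (Finset.mem_erase.2 ⟨hσl, hσ⟩) y hy)
    · obtain ⟨τ, hτ, h, -⟩ := c.last.isPartialDecomposition
      refine ⟨τ, hτ, fun σ hσ => ?_⟩
      rwa [by_contra fun hσl => hne ⟨σ, Finset.mem_erase.2 ⟨hσl, hσ⟩⟩]

/-- The map `u : Δ PD → CB`. -/
def toCB (hEP : F.EP) : OrderComplex F.PD →o F.CB where
  toFun c :=
    { carrier := ⋃ σ ∈ c.carrier, σ.carrier
      nonempty := by
        obtain ⟨σ, hσ⟩ := c.nonempty
        obtain ⟨x, hx⟩ := σ.nonempty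
        exact ⟨x, Set.mem_biUnion (Finset.mem_coe.2 hσ) hx⟩
      compatible := by
        obtain ⟨τ, hτ, h⟩ := hEP.exists_frame c
        refine ⟨τ, hτ, fun y hy => ?_⟩
        obtain ⟨σ, hσ, hy⟩ := Set.mem_iUnion₂.1 hy
        exact h σ hσ y hy }
  monotone' _ _ h := Set.biUnion_subset_biUnion_left h

theorem mem_toCB (hEP : F.EP) {c : OrderComplex F.PD} {x : S} :
    x ∈ (toCB hEP c).carrier ↔ ∃ σ ∈ c.carrier, x ∈ σ.carrier := by
  change x ∈ ⋃ σ ∈ c.carrier, σ.carrier ↔ _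
  simp

/-! ### Comparison of the two composites with the last vertex maps -/

/-- Each $m(c)$ consists of meets of elements of the largest member of `c`. These meets need not lie
in that member, so the last-vertex map is reached only through its closure. -/
theorem toCB_comp_mapHom_toPD_le (hEP : F.EP) :
    (toCB hEP).comp (mapHom (toPD F)) ≤
      (CB.meetClosureHom F).comp ((lastHom F.CB).comp (lastHom (OrderComplex F.CB))) := by
  intro C x hx
  obtain ⟨σ, hσ, hx⟩ := (mem_toCB hEP).1 hx
  obtain ⟨c, hc, rfl⟩ := mem_mapHom.1 hσ
  exact meetClosure_mono (C.last.le_last (C.le_last hc c.last_mem)) (minUnion_subset c hx.1)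

theorem le_meetClosureHom_comp :
    (lastHom F.CB).comp (lastHom (OrderComplex F.CB)) ≤
      (CB.meetClosureHom F).comp ((lastHom F.CB).comp (lastHom (OrderComplex F.CB))) :=
  fun C => CB.le_meetClosure C.last.last

/-- A meet lies below some element of a member of the chain, and that element lies below an element
of the largest member. -/
theorem toPD_comp_mapHom_toCB_le (hEP : F.EP) :
    (toPD F).comp (mapHom (toCB hEP)) ≤ (lastHom F.PD).comp (lastHom (OrderComplex F.PD)) := by
  intro C x hx
  obtain ⟨σ, hσ, hxσ⟩ := mem_minUnion.1 hx.1
  obtain ⟨c, hc, rfl⟩ := mem_mapHom.1 hσ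
  obtain ⟨y, hy, hxy⟩ := exists_le_of_mem_meetClosure hxσ.1
  obtain ⟨π, hπ, hyπ⟩ := (mem_toCB hEP).1 hy
  obtain ⟨z, hz, hyz⟩ := C.last.le_last (C.le_last hc hπ) y hyπ
  exact ⟨z, hz, hxy.trans hyz⟩

section Equivariance

variable {G : Type*} [Group G] [MulAction G S] [IsGPoset G S] [F.IsInvariant G]

theorem CB.smul_carrier (g : G) (σ : F.CB) : (g • σ).carrier = g • σ.carrier := rfl

theorem CB.isEquivariant_meetClosureHom : IsEquivariant G (CB.meetClosureHom F) :=
  fun g σ => CB.ext (meetClosure_smul g σ.carrier)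

theorem minUnion_smul (g : G) (c : OrderComplex F.CB) : minUnion (g • c) = g • minUnion c := by
  ext x
  rw [mem_minUnion, Set.mem_smul_set]
  constructor
  · rintro ⟨_, hgσ, hx⟩
    obtain ⟨σ, hσ, rfl⟩ := mem_smul.1 hgσ
    rw [CB.smul_carrier, meetClosure_smul, minSet_smul] at hx
    obtain ⟨y, hy, rfl⟩ := hx
    exact ⟨y, mem_minUnion.2 ⟨σ, hσ, hy⟩, rfl⟩
  · rintro ⟨y, hy, rfl⟩
    obtain ⟨σ, hσ, hy⟩ := mem_minUnion.1 hy
    refine ⟨g • σ, mem_smul.2 ⟨σ, hσ, rfl⟩, ?_⟩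
    rw [CB.smul_carrier, meetClosure_smul, minSet_smul]
    exact Set.smul_mem_smul_set hy

theorem isEquivariant_toPD : IsEquivariant G (toPD F) := by
  intro g c
  apply PD.ext
  change maxSet (minUnion (g • c)) = g • maxSet (minUnion c)
  rw [minUnion_smul, maxSet_smul]

theorem isEquivariant_toCB (hEP : F.EP) : IsEquivariant G (toCB hEP) := by
  intro g c
  apply CB.ext
  ext x
  rw [CB.smul_carrier, mem_toCB hEP, Set.mem_smul_set]
  constructor
  · rintro ⟨_, hgσ, hx⟩
    obtain ⟨σ, hσ, rfl⟩ := mem_smul.1 hgσ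
    obtain ⟨y, hy, rfl⟩ := hx
    exact ⟨y, (mem_toCB hEP).2 ⟨σ, hσ, hy⟩, rfl⟩
  · rintro ⟨y, hy, rfl⟩
    obtain ⟨σ, hσ, hy⟩ := (mem_toCB hEP).1 hy
    exact ⟨g • σ, mem_smul.2 ⟨σ, hσ, rfl⟩, Set.smul_mem_smul_set hy⟩

open Realization

theorem isGHomotopyInverse_ofSubdivision (hEP : F.EP) :
    IsGHomotopyInverse G (ofSubdivision (toPD F)) (ofSubdivision (toCB hEP)) := by
  have hm : IsEquivariant G (toPD F) := isEquivariant_toPD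
  have hu : IsEquivariant G (toCB hEP) := isEquivariant_toCB hEP
  have hlastCB : IsEquivariant G ((lastHom F.CB).comp (lastHom (OrderComplex F.CB))) :=
    isEquivariant_last.comp isEquivariant_last
  have hlastPD : IsEquivariant G ((lastHom F.PD).comp (lastHom (OrderComplex F.PD))) :=
    isEquivariant_last.comp isEquivariant_last
  have hcl := CB.isEquivariant_meetClosureHom.comp hlastCB
  refine ⟨isEquivariant_ofSubdivision hm, isEquivariant_ofSubdivision hu,
    gHomotopic_ofSubdivision_comp hm hu ?_, gHomotopic_ofSubdivision_comp hu hm ?_⟩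
  · exact (gHomotopic_map_of_le (toCB_comp_mapHom_toPD_le hEP)
      (hu.comp (isEquivariant_mapHom hm)) hcl).trans
      (gHomotopic_map_of_le le_meetClosureHom_comp hlastCB hcl).symm
  · exact gHomotopic_map_of_le (toPD_comp_mapHom_toCB_le hEP)
      (hm.comp (isEquivariant_mapHom hu)) hlastPD

end Equivariance

end FrameFamily

end CommonBasis

/-! ### The main theorem -/

theorem theorem2p9 {G : Type*} [Group G] {S : Type*} [PartialOrder S] [MulAction G S]
    [IsGPoset G S] (F : FrameFamily S) [F.IsInvariant G] (hEP : F.EP) :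
    ∃ (m : OrderComplex F.CB →o F.PD) (u : OrderComplex F.PD →o F.CB),
      (∀ c, (m c).carrier = maxSet (⋃ σ ∈ c.carrier, minSet (meetClosure σ.carrier))) ∧
      (∀ c, (u c).carrier = ⋃ σ ∈ c.carrier, σ.carrier) ∧
      IsEquivariant G m ∧ IsEquivariant G u ∧
      IsGHomotopyEquiv G (Realization.map m) ∧ IsGHomotopyEquiv G (Realization.map u) ∧
      ∃ (Φ : C(Realization F.CB, Realization F.PD)) (Ψ : C(Realization F.PD, Realization F.CB)),
        IsGHomotopyInverse G Φ Ψ ∧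
        (∀ x, Φ (Realization.subdivision x) = Realization.map m x) ∧
        (∀ x, Ψ (Realization.subdivision x) = Realization.map u x) := by
  have h := FrameFamily.isGHomotopyInverse_ofSubdivision (G := G) hEP
  have hm := Realization.ofSubdivision_comp_sd (FrameFamily.toPD F)
  have hu := Realization.ofSubdivision_comp_sd (FrameFamily.toCB hEP)
  refine ⟨FrameFamily.toPD F, FrameFamily.toCB hEP, fun _ => rfl, fun _ => rfl,
    FrameFamily.isEquivariant_toPD, FrameFamily.isEquivariant_toCB hEP,
    -- $|m|=\Phi\circ\mathrm{sd}$ and $|u|=\Psi\circ\mathrm{sd}$ are equivalences because `sd` is an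
    -- equivariant homeomorphism.
    ⟨_, hm ▸ Realization.isGHomotopyInverse_comp_sd h⟩,
    ⟨_, hu ▸ Realization.isGHomotopyInverse_comp_sd h.symm⟩, _, _, h,
    DFunLike.congr_fun hm, DFunLike.congr_fun hu⟩
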